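/- Let $k$ be a field and let $A=kQ/I$ be a gentle algebra: $Q$ is a finite quiver, $I$ is an admissible ideal of the path algebra $kQ$ generated by paths of length $2$, at most two arrows start and at most two arrows end at each vertex, and for each arrow $\alpha$ there is at most one arrow $\beta$ starting where $\alpha$ ends with $\beta\alpha\notin I$, at most one such $\beta$ with $\beta\alpha\in I$, at most one arrow $\gamma$ ending where $\alpha$ starts with $\alpha\gamma\notin I$, and at most one such $\gamma$ with $\alpha\gamma\in I$ (paths are written from right to left). **The Brauer graph with cutting set of $T(A)$.** A path $p\notin I$ of $Q$ is *maximal* if $\alpha p,p\alpha\in I$ for all arrows $\alpha$ that can be composed with it. The ribbon graph $\Gamma=(V,H,s,\iota,\rho)$ of $A$ has as vertices the maximal paths, together with one additional vertex $\mathsf v_x$ for each vertex $x$ of $Q$ such that (a) $x$ is a source with a single arrow starting at $x$, or (b) $x$ is a sink with a single arrow ending at $x$, or (c) a single arrow $\alpha$ ends at $x$, a single arrow $\beta$ starts at $x$, and $\beta\alpha\notin I$, or (d) no arrow starts or ends at $x$. The half-edges at a maximal path are its successive passages through vertices of $Q$ (one more than its length), and there is a single half-edge, belonging to $x$, at $\mathsf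 v_x$. The map $s$ sends a half-edge to its vertex, $\iota$ exchanges the two half-edges that belong to the same vertex of $Q$ (so the edges of $\Gamma$ are the vertices of $Q$), and $\rho$ sends a passage of a maximal path to the next one and the last passage to the first one. Let $d(\mathsf v)=\mathrm{val}(\mathsf v)=|s^{-1}(\mathsf v)|$, and let $D$ consist of the last half-edge at each vertex (that is, of the arrows $\alpha_h$ of $Q_\Gamma$, defined below, that are not arrows of $Q$). **Coverings.** $\Gamma_D^{\mathbb Z}$ (respectively $\Gamma_D^{(r)}$, for $r\ge 1$) has the same vertices as $\Gamma$ and the half-edges $h^{(j)}$ with $h\in H$ and $j\in\mathbb Z$ (respectively $j\in\mathbb Z/r\mathbb Z$), with $s(h^{(j)})=s(h)$, $\iota(h^{(j)})=\iota(h)^{(j)}$, $\rho(h^{(j)})=\rho(h)^{(j)}$ if $h\notin D$, and $\rho(h^{(j)})=\rho(h)^{(j+1)}$ if $h\in D$. **Admissible fractional Brauer graph algebras.** A ribbon graph with a degree function $d:V\to\mathbb Z_{>0}$ is an *admissible fractional Brauer graph* if $\iota(\rho^{d(s(h))}(h))=\rho^{d(s(\iota(h)))}(\iota(h))$ and $\rho^{n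 d(s(h))}(h)\ne\iota(h)$ for all half-edges $h$ and all $n\in\mathbb Z$; it is a *Brauer graph* if moreover all $d(\mathsf v)/\mathrm{val}(\mathsf v)$ are integers. Its algebra (AFBGA) is $kQ_\Gamma/I_{\Gamma,d}$, where the vertices of $Q_\Gamma$ are the $\iota$-orbits $\bar h$, each half-edge $h$ gives an arrow $\alpha_h:\bar h\to\overline{\rho(h)}$, and $I_{\Gamma,d}$ is generated by the following elements: for $\bar h=\overline{h'}$, the difference of the path with successive arrows $\alpha_h,\alpha_{\rho(h)},\dots,\alpha_{\rho^{d(s(h))-1}(h)}$ and the path with successive arrows $\alpha_{h'},\alpha_{\rho(h')},\dots,\alpha_{\rho^{d(s(h'))-1}(h')}$; and, for $\overline{\rho(h)}=\overline{h'}$ with $\rho(h)\ne h'$, the path of length two "first $\alpha_h$, then $\alpha_{h'}$". **Repetitive algebra.** Let $DA=\mathrm{Hom}_k(A,k)$. The repetitive algebra $\hat A$ consists of the sequences $(a_i,f_i)_{i\in\mathbb Z}$ with $a_i\in A$, $f_i\in DA$ and finitely many nonzero terms, with product $(a_i,f_i)(a_i',f_i')=(a_ia_i',\,a_if_i'+f_ia_{i+1}')$.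 Its Nakayama automorphism $\nu$ is the shift of sequences by one place, and the $r$-fold trivial extension is the orbit algebra $T_r(A)=\hat A/\langle\nu^r\rangle$, that is, the algebra of all (not necessarily finitely supported) sequences $(a_i,f_i)_{i\in\mathbb Z}$ that are invariant under $\nu^r$, with the same product; $T(A)=T_1(A)$. **Theorem.** $(\Gamma,d)$ is a Brauer graph, and $D$ is a cutting set of it, i.e. it contains exactly one half-edge at each vertex. Moreover: 1. $(\Gamma_D^{\mathbb Z},d)$ is an admissible fractional Brauer graph, and its AFBGA is isomorphic, as a $k$-algebra (without unit in general), to the repetitive algebra $\hat A$. 2. For every $r\ge 1$, $(\Gamma_D^{(r)},d)$ is an admissible fractional Brauer graph, and its AFBGA is isomorphic, as a $k$-algebra, to the $r$-fold trivial extension $T_r(A)=\hat A/\langle\nu^r\rangle$. -/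

import Mathlib

noncomputable section

open Quiver

universe u v w

/-! ### Path algebras of quivers and their quotients -/

/-- All paths of a quiver, with arbitrary source and target. -/
abbrev AllPaths (Q : Type u) [Quiver.{v} Q] := Σ a b : Q, Path a b

/-- The path algebra `kQ`: the `k`-vector space on the set of all paths of `Q`.  The quiver may be
infinite, so the algebra need not have a unit. -/
def PathAlgebra (k : Type w) [Field k] (Q : Type u) [Quiver.{v} Q] := AllPaths Q →₀ k

namespace PathAlgebra

variable (k : Type w) [Field k] {Q : Type u} [Quiver.{v} Q]

instance : AddCommGroup (PathAlgebra k Q) := inferInstanceAs (AddCommGroup (AllPaths Q →₀ k))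

instance : Module k (PathAlgebra k Q) := inferInstanceAs (Module k (AllPaths Q →₀ k))

variable (Q) in
/-- The coefficients of an element of `kQ` with respect to the basis of paths. -/
def coeff : PathAlgebra k Q ≃ₗ[k] (AllPaths Q →₀ k) := LinearEquiv.refl k (AllPaths Q →₀ k)

/-- A path, as an element of the path algebra. -/
def ofPath {a b : Q} (p : Path a b) : PathAlgebra k Q :=
  (coeff k Q).symm (Finsupp.single ⟨a, b, p⟩ 1)

open Classical in
/-- The product of two paths.  Paths are written from right to left, so `p * q` is the path
"first `q`, then `p`" if `q` ends where `p` starts, and `0` otherwise. -/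
def mulPaths (p q : AllPaths Q) : PathAlgebra k Q :=
  if h : q.2.1 = p.1 then ofPath k ((q.2.2.cast rfl h).comp p.2.2) else 0

/-- Bilinear extension of the product of paths. -/
def mulLin : PathAlgebra k Q →ₗ[k] PathAlgebra k Q →ₗ[k] PathAlgebra k Q :=
  Finsupp.lift _ k _ (fun p => Finsupp.lift _ k _ (fun q => mulPaths k p q) ∘ₗ
    (coeff k Q).toLinearMap) ∘ₗ (coeff k Q).toLinearMap

instance : Mul (PathAlgebra k Q) := ⟨fun x y => mulLin k x y⟩

variable {k}

theorem mul_def (x y : PathAlgebra k Q) : x * y = mulLin k x y := rfl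

theorem ofPath_mul_ofPath_eq {a b c d : Q} (p : Path a b) (q : Path c d) :
    ofPath k p * ofPath k q = mulPaths k ⟨a, b, p⟩ ⟨c, d, q⟩ := by
  simp [mul_def, mulLin, ofPath]

theorem induction_paths {motive : PathAlgebra k Q → Prop} (x : PathAlgebra k Q)
    (zero : motive 0) (add : ∀ x y, motive x → motive y → motive (x + y))
    (smul : ∀ (c : k) (a b : Q) (p : Path a b), motive (c • ofPath k p)) : motive x := by
  obtain ⟨f, rfl⟩ := (coeff k Q).symm.surjective x
  induction f using Finsupp.induction_linear with
  | zero => rwa [map_zero]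
  | add f g hf hg => rw [map_add]; exact add _ _ hf hg
  | single p c =>
    have := smul c p.1 p.2.1 p.2.2
    rwa [ofPath, ← map_smul, Finsupp.smul_single, smul_eq_mul, mul_one] at this

theorem ofPath_mul_ofPath {a b c : Q} (p : Path b c) (q : Path a b) :
    ofPath k p * ofPath k q = ofPath k (q.comp p) := by
  rw [ofPath_mul_ofPath_eq]
  simp [mulPaths]

theorem ofPath_mul_ofPath_of_ne {a b b' c : Q} (p : Path b c) (q : Path a b') (h : b' ≠ b) :
    ofPath k p * ofPath k q = 0 := by
  rw [ofPath_mul_ofPath_eq]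
  simp [mulPaths, h]

theorem smul_mul' (c : k) (x y : PathAlgebra k Q) : (c • x) * y = c • (x * y) := by
  simp [mul_def]

theorem mul_smul' (c : k) (x y : PathAlgebra k Q) : x * (c • y) = c • (x * y) := by
  simp [mul_def]

instance : NonUnitalNonAssocRing (PathAlgebra k Q) where
  left_distrib x y z := by simp [mul_def]
  right_distrib x y z := by simp [mul_def]
  zero_mul x := by simp [mul_def]
  mul_zero x := by simp [mul_def]

theorem ofPath_assoc {a b c d e f : Q} (p : Path a b) (q : Path c d) (r : Path e f) :
    ofPath k p * ofPath k q * ofPath k r = ofPath k p * (ofPath k q * ofPath k r) := by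
  by_cases h : d = a
  · subst h
    rw [ofPath_mul_ofPath]
    by_cases h' : f = c
    · subst h'
      rw [ofPath_mul_ofPath, ofPath_mul_ofPath, ofPath_mul_ofPath, Path.comp_assoc]
    · rw [ofPath_mul_ofPath_of_ne _ _ h', ofPath_mul_ofPath_of_ne _ _ h', mul_zero]
  · rw [ofPath_mul_ofPath_of_ne _ _ h, zero_mul]
    by_cases h' : f = c
    · subst h'
      rw [ofPath_mul_ofPath, ofPath_mul_ofPath_of_ne _ _ h]
    · rw [ofPath_mul_ofPath_of_ne _ _ h', mul_zero]

instance : NonUnitalRing (PathAlgebra k Q) where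
  mul_assoc x y z := by
    induction x using induction_paths with
    | zero => simp
    | add x x' hx hx' => simp only [add_mul, hx, hx']
    | smul c a b p =>
      induction y using induction_paths with
      | zero => simp
      | add y y' hy hy' => simp only [add_mul, mul_add, hy, hy']
      | smul c' a' b' q =>
        induction z using induction_paths with
        | zero => simp
        | add z z' hz hz' => simp only [mul_add, hz, hz']
        | smul c'' a'' b'' r => simp only [smul_mul', mul_smul', ofPath_assoc]

instance : IsScalarTower k (PathAlgebra k Q) (PathAlgebra k Q) := ⟨smul_mul'⟩

instance : SMulCommClass k (PathAlgebra k Q) (PathAlgebra k Q) :=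
  ⟨fun c x y => (mul_smul' c x y).symm⟩

/-- Every element has a left unit (a sum of trivial paths). -/
theorem exists_mul_eq_self (x : PathAlgebra k Q) : ∃ e : PathAlgebra k Q, e * x = x := by
  classical
  let e : Finset Q → PathAlgebra k Q := fun S => ∑ v ∈ S, ofPath k (Path.nil : Path v v)
  have key : ∀ (S : Finset Q) {a b : Q} (p : Path a b), b ∈ S →
      e S * ofPath k p = ofPath k p := by
    intro S a b p hb
    simp only [e, Finset.sum_mul]
    rw [Finset.sum_eq_single b]
    · rw [ofPath_mul_ofPath, Path.comp_nil]
    · intro v _ hv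
      exact ofPath_mul_ofPath_of_ne _ _ (Ne.symm hv)
    · exact fun h => (h hb).elim
  suffices ∃ S : Finset Q, ∀ T, S ⊆ T → e T * x = x from
    let ⟨S, hS⟩ := this; ⟨e S, hS S subset_rfl⟩
  induction x using induction_paths with
  | zero => exact ⟨∅, fun _ _ => mul_zero _⟩
  | add x y hx hy =>
    obtain ⟨S, hS⟩ := hx
    obtain ⟨T, hT⟩ := hy
    exact ⟨S ∪ T, fun U hU => by
      rw [mul_add, hS U (Finset.union_subset_left hU), hT U (Finset.union_subset_right hU)]⟩
  | smul c a b p =>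
    exact ⟨{b}, fun T hT => by rw [mul_smul', key T p (hT (by simp))]⟩

theorem smul_mem (I : TwoSidedIdeal (PathAlgebra k Q)) (c : k) {x : PathAlgebra k Q}
    (hx : x ∈ I) : c • x ∈ I := by
  obtain ⟨e, he⟩ := exists_mul_eq_self x
  rw [← he, ← smul_mul']
  exact I.mul_mem_left _ _ hx

end PathAlgebra

/-- The algebra `kQ/I`. -/
def BoundQuiverAlgebra {k : Type w} [Field k] {Q : Type u} [Quiver.{v} Q]
    (I : TwoSidedIdeal (PathAlgebra k Q)) := I.ringCon.Quotient

namespace BoundQuiverAlgebra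

variable {k : Type w} [Field k] {Q : Type u} [Quiver.{v} Q] (I : TwoSidedIdeal (PathAlgebra k Q))

instance : NonUnitalRing (BoundQuiverAlgebra I) := inferInstanceAs (NonUnitalRing I.ringCon.Quotient)

/-- The quotient map `kQ → kQ/I`. -/
def mk (x : PathAlgebra k Q) : BoundQuiverAlgebra I := (x : I.ringCon.Quotient)

theorem mk_surjective : Function.Surjective (mk I) := Quotient.mk_surjective

theorem mk_add (x y : PathAlgebra k Q) : mk I (x + y) = mk I x + mk I y := rfl

theorem mk_mul (x y : PathAlgebra k Q) : mk I (x * y) = mk I x * mk I y := rfl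

theorem mk_zero : mk I 0 = 0 := rfl

theorem mk_eq_mk {x y : PathAlgebra k Q} : mk I x = mk I y ↔ x - y ∈ I :=
  (RingCon.eq I.ringCon).trans (I.rel_iff x y)

instance : SMul k (BoundQuiverAlgebra I) :=
  ⟨fun c => Quotient.map' (fun x => c • x) fun x y h => by
    have h' : x - y ∈ I := (I.rel_iff x y).1 h
    refine (I.rel_iff _ _).2 ?_
    rw [← smul_sub]
    exact PathAlgebra.smul_mem I c h'⟩

theorem mk_smul (c : k) (x : PathAlgebra k Q) : mk I (c • x) = c • mk I x := rfl

instance : Module k (BoundQuiverAlgebra I) :=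
  Function.Surjective.module k
    ({ toFun := mk I, map_zero' := rfl, map_add' := fun _ _ => rfl } :
      PathAlgebra k Q →+ BoundQuiverAlgebra I) (mk_surjective I) (mk_smul I)

instance : IsScalarTower k (BoundQuiverAlgebra I) (BoundQuiverAlgebra I) := ⟨fun c x y => by
  obtain ⟨x, rfl⟩ := mk_surjective I x
  obtain ⟨y, rfl⟩ := mk_surjective I y
  simp only [smul_eq_mul, ← mk_smul, ← mk_mul, PathAlgebra.smul_mul']⟩

instance : SMulCommClass k (BoundQuiverAlgebra I) (BoundQuiverAlgebra I) := ⟨fun c x y => by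
  obtain ⟨x, rfl⟩ := mk_surjective I x
  obtain ⟨y, rfl⟩ := mk_surjective I y
  simp only [smul_eq_mul, ← mk_smul, ← mk_mul, PathAlgebra.mul_smul']⟩

end BoundQuiverAlgebra

/-! ### Repetitive algebras and `r`-fold trivial extensions -/

/-- All sequences `(aᵢ, fᵢ)`, `i ∈ ℤ`, with `aᵢ ∈ A` and `fᵢ ∈ DA = Hom_k(A, k)`, without any
finiteness condition. -/
def BiSeq (k : Type u) [Field k] (A : Type v) [NonUnitalRing A] [Module k A] :=
  ℤ → A × Module.Dual k A

namespace BiSeq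

variable (k : Type u) [Field k] (A : Type v) [NonUnitalRing A] [Module k A]

instance : AddCommGroup (BiSeq k A) := inferInstanceAs (AddCommGroup (ℤ → A × Module.Dual k A))

instance : Module k (BiSeq k A) := inferInstanceAs (Module k (ℤ → A × Module.Dual k A))

variable {k A}

theorem add_apply (x y : BiSeq k A) (i : ℤ) : (x + y) i = x i + y i := rfl

theorem zero_apply (i : ℤ) : (0 : BiSeq k A) i = 0 := rfl

theorem smul_apply (c : k) (x : BiSeq k A) (i : ℤ) : (c • x) i = c • x i := rfl

theorem ext' {x y : BiSeq k A} (h₁ : ∀ i, (x i).1 = (y i).1)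
    (h₂ : ∀ i b, (x i).2 b = (y i).2 b) : x = y :=
  funext fun i => Prod.ext (h₁ i) (LinearMap.ext (h₂ i))

variable [IsScalarTower k A A] [SMulCommClass k A A]

/-- The left action of `A` on `DA`: `(a f)(b) = f (b a)`. -/
def dualLeft (a : A) (f : Module.Dual k A) : Module.Dual k A := f ∘ₗ LinearMap.mulRight k a

/-- The right action of `A` on `DA`: `(f a)(b) = f (a b)`. -/
def dualRight (f : Module.Dual k A) (a : A) : Module.Dual k A := f ∘ₗ LinearMap.mulLeft k a

/-- `(aᵢ, fᵢ) (aᵢ', fᵢ') = (aᵢ aᵢ', aᵢ fᵢ' + fᵢ aᵢ₊₁')`. -/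
instance : Mul (BiSeq k A) :=
  ⟨fun x y i => ((x i).1 * (y i).1, dualLeft (x i).1 (y i).2 + dualRight (x i).2 (y (i + 1)).1)⟩

theorem mul_apply (x y : BiSeq k A) (i : ℤ) : (x * y) i =
    ((x i).1 * (y i).1, dualLeft (x i).1 (y i).2 + dualRight (x i).2 (y (i + 1)).1) := rfl

instance : NonUnitalRing (BiSeq k A) where
  left_distrib x y z := ext' (fun i => by simp [mul_apply, add_apply, mul_add])
    (fun i b => by simp [mul_apply, add_apply, dualLeft, dualRight, add_mul, mul_add]; abel)
  right_distrib x y z := ext' (fun i => by simp [mul_apply, add_apply, add_mul])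
    (fun i b => by simp [mul_apply, add_apply, dualLeft, dualRight, add_mul, mul_add]; abel)
  zero_mul x := ext' (fun i => by simp [mul_apply, zero_apply])
    (fun i b => by simp [mul_apply, zero_apply, dualLeft, dualRight])
  mul_zero x := ext' (fun i => by simp [mul_apply, zero_apply])
    (fun i b => by simp [mul_apply, zero_apply, dualLeft, dualRight])
  mul_assoc x y z := ext' (fun i => by simp [mul_apply, mul_assoc])
    (fun i b => by simp [mul_apply, dualLeft, dualRight, mul_assoc, add_assoc])

instance : IsScalarTower k (BiSeq k A) (BiSeq k A) :=
  ⟨fun c x y => ext' (fun i => by simp [mul_apply, smul_apply, smul_mul_assoc])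
    (fun i b => by simp [mul_apply, smul_apply, dualLeft, dualRight, mul_smul_comm])⟩

instance : SMulCommClass k (BiSeq k A) (BiSeq k A) :=
  ⟨fun c x y => ext' (fun i => by simp [mul_apply, smul_apply, mul_smul_comm])
    (fun i b => by simp [mul_apply, smul_apply, dualLeft, dualRight, smul_mul_assoc])⟩

variable (k A)

/-- The Nakayama automorphism `ν`: the shift `aᵢ ↦ aᵢ₊₁`, `fᵢ ↦ fᵢ₊₁`, which moves the entry at
position `i` to position `i + 1`. -/
def nakayama : BiSeq k A →ₙₐ[k] BiSeq k A where
  toFun x i := x (i - 1)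
  map_smul' _ _ := rfl
  map_zero' := rfl
  map_add' _ _ := rfl
  map_mul' x y := funext fun i => Prod.ext rfl <|
    congrArg (fun j => dualLeft (x (i - 1)).1 (y (i - 1)).2 + dualRight (x (i - 1)).2 (y j).1)
      (show i - 1 + 1 = i + 1 - 1 by ring)

end BiSeq

/-- The repetitive algebra `Â`: the sequences `(aᵢ, fᵢ)` with only finitely many nonzero terms. -/
def RepetitiveAlgebra (k : Type u) [Field k] (A : Type v) [NonUnitalRing A] [Module k A]
    [IsScalarTower k A A] [SMulCommClass k A A] : NonUnitalSubalgebra k (BiSeq k A) where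
  carrier := {x | {i | x i ≠ 0}.Finite}
  zero_mem' := by simp [BiSeq.zero_apply]
  add_mem' {x y} hx hy := (hx.union hy).subset fun i hi => by
    by_contra h
    simp only [Set.mem_union, Set.mem_ofPred_eq, not_or, not_not] at h
    exact hi (by rw [BiSeq.add_apply, h.1, h.2, add_zero])
  mul_mem' {x y} hx _ := hx.subset fun i hi h => hi <| Prod.ext
    (by simp [BiSeq.mul_apply, h])
    (LinearMap.ext fun b => by simp [BiSeq.mul_apply, h, BiSeq.dualLeft, BiSeq.dualRight])
  smul_mem' c x hx := hx.subset fun i hi h => hi (by rw [BiSeq.smul_apply, h, smul_zero])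

/-- The `r`-fold trivial extension `T_r(A) = Â/⟨ν^r⟩`, as the orbit algebra in the sense of
covering theory: for a group `G` acting freely on a locally bounded category `B`, a morphism
`a → b` of `B/G` is a family of morphisms `f y x ∈ B(x, y)`, `x ∈ a`, `y ∈ b`, with
`g (f y x) = f (g y) (g x)` for `g ∈ G`.  For `B = Â` such families are exactly the (not
necessarily finitely supported) sequences `(aᵢ, fᵢ)` that are invariant under `G = ⟨ν^r⟩`. -/
def TrivialExtension (k : Type u) [Field k] (A : Type v) [NonUnitalRing A] [Module k A]
    [IsScalarTower k A A] [SMulCommClass k A A] (r : ℕ) : NonUnitalSubalgebra k (BiSeq k A) where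
  carrier := {x | (BiSeq.nakayama k A)^[r] x = x}
  zero_mem' := Function.iterate_fixed (map_zero _) r
  add_mem' {x y} hx hy := by
    simp only [Set.mem_ofPred_eq] at *
    rw [iterate_map_add, hx, hy]
  mul_mem' {x y} hx hy := by
    simp only [Set.mem_ofPred_eq] at *
    rw [iterate_map_mul, hx, hy]
  smul_mem' c x hx := by
    simp only [Set.mem_ofPred_eq] at *
    have h : Function.Commute (BiSeq.nakayama k A) (c • · : BiSeq k A → BiSeq k A) :=
      fun y => map_smul _ c y
    exact (h.iterate_left r x).trans (congrArg (c • ·) hx)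

/-! ### Ribbon graphs, admissible fractional Brauer graphs and their algebras -/

/-- The data `(V, H, s, ι, ρ)` of a ribbon graph; the laws are in `RibbonData.IsRibbonGraph`. -/
structure RibbonData (V : Type u) (H : Type v) where
  /-- the vertex at which a half-edge is attached -/
  s : H → V
  /-- the other half of the edge -/
  ι : H → H
  /-- the successor in the cyclic order at a vertex -/
  ρ : Equiv.Perm H

namespace RibbonData

variable {V : Type u} {H : Type v} (Γ : RibbonData V H)

/-- `Γ` is a ribbon graph: there are finitely many vertices, `ι` is an involution without fixed
points, and the cycles of `ρ` are exactly the sets `s⁻¹(v)`, `v ∈ V`. -/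
structure IsRibbonGraph : Prop where
  finite_vertices : Finite V
  involutive : Function.Involutive Γ.ι
  ι_ne : ∀ h, Γ.ι h ≠ h
  surjective : Function.Surjective Γ.s
  sameCycle_iff : ∀ h h', Γ.ρ.SameCycle h h' ↔ Γ.s h = Γ.s h'

/-- The valency of a vertex. -/
def val (v : V) : ℕ := Nat.card {h : H // Γ.s h = v}

/-- The Nakayama automorphism `h ↦ ρ^{d(s(h))}(h)` of `(Γ, d)`. -/
def nakayama (d : V → ℕ) (h : H) : H := (Γ.ρ ^ d (Γ.s h)) h

/-- `(Γ, d)` is an admissible fractional Brauer graph. -/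
structure IsAFBG (d : V → ℕ) : Prop where
  isRibbonGraph : Γ.IsRibbonGraph
  degree_pos : ∀ v, 0 < d v
  ι_nakayama : ∀ h, Γ.ι ((Γ.ρ ^ d (Γ.s h)) h) = (Γ.ρ ^ d (Γ.s (Γ.ι h))) (Γ.ι h)
  admissible : ∀ (h : H) (n : ℤ), (Γ.ρ ^ (n * (d (Γ.s h) : ℤ))) h ≠ Γ.ι h

/-- `(Γ, d)` is a (classical) Brauer graph: an admissible fractional Brauer graph with finite
valencies all of whose multiplicities `d(v) / val(v)` are integers. -/
structure IsBrauerGraph (d : V → ℕ) : Prop where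
  isAFBG : Γ.IsAFBG d
  val_pos : ∀ v, 0 < Γ.val v
  val_dvd : ∀ v, Γ.val v ∣ d v

/-- The edges of `Γ`: the orbits of `ι`. -/
def Edge := Quot fun h h' : H => Γ.ι h = h'

/-- The edge to which a half-edge belongs. -/
def edge (h : H) : Γ.Edge := Quot.mk _ h

/-- The quiver `Q_Γ`: its vertices are the edges of `Γ`, and each half-edge `h` gives an arrow
`α_h` from the edge of `h` to the edge of `h⁺ = ρ(h)`. -/
instance : Quiver Γ.Edge where
  Hom e e' := {h : H // Γ.edge h = e ∧ Γ.edge (Γ.ρ h) = e'}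

/-- The arrow `α_h`. -/
def arrow (h : H) : Γ.edge h ⟶ Γ.edge (Γ.ρ h) := ⟨h, rfl, rfl⟩

/-- The path of length `n` with arrows `α_h, α_{ρ(h)}, …, α_{ρ^{n-1}(h)}`, in this order. -/
def run (h : H) : (n : ℕ) → Path (Γ.edge h) (Γ.edge ((Γ.ρ ^ n) h))
  | 0 => Path.nil
  | n + 1 => ((run h n).cons (Γ.arrow ((Γ.ρ ^ n) h))).cast rfl
      (by rw [pow_succ', Equiv.Perm.mul_apply])

/-- The generators of the ideal `I_{Γ,d}`: for two arrows `α_h`, `α_{h'}` that start at the same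
edge, the difference of the paths `α_h ⋯ α_{ρ^{d(s(h)) - 1}(h)}` and
`α_{h'} ⋯ α_{ρ^{d(s(h')) - 1}(h')}`; and for two composable arrows, the path "first `α_h`, then
`α_{h'}`" if `ρ(h) ≠ h'`. -/
inductive Relation (k : Type w) [Field k] (d : V → ℕ) : PathAlgebra k Γ.Edge → Prop
  | commutativity (h h' : H) (hh' : Γ.edge h = Γ.edge h') :
      Relation k d (PathAlgebra.ofPath k (Γ.run h (d (Γ.s h))) -
        PathAlgebra.ofPath k (Γ.run h' (d (Γ.s h'))))
  | zero (h h' : H) (hh' : Γ.edge (Γ.ρ h) = Γ.edge h') (hne : Γ.ρ h ≠ h') :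
      Relation k d (PathAlgebra.ofPath k (Γ.arrow h').toPath *
        PathAlgebra.ofPath k (Γ.arrow h).toPath)

/-- The algebra `kQ_Γ / I_{Γ,d}`; if `(Γ, d)` is an admissible fractional Brauer graph, this is the
associated admissible fractional Brauer graph algebra. -/
abbrev AFBGA (k : Type w) [Field k] (d : V → ℕ) :=
  BoundQuiverAlgebra (TwoSidedIdeal.span {x | Γ.Relation k d x})

/-- A cutting set contains exactly one half-edge `h` (equivalently, exactly one arrow `α_h`, or
exactly one angle from `h` to `ρ(h)`) at each vertex. -/
def IsCuttingSet (D : Set H) : Prop := ∀ v, ∃! h, Γ.s h = v ∧ h ∈ D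

open Classical in
/-- The covering graph of `Γ` with respect to `D`, with sheets indexed by `J`.  Its half-edges are
the `h^{(j)} = (h, j)`, with `s(h^{(j)}) = s(h)`, `ι(h^{(j)}) = ι(h)^{(j)}`, and `ρ(h^{(j)})` is
`ρ(h)^{(j)}` if the angle from `h` to `ρ(h)` is not cut, and `ρ(h)^{(j+1)}` if it is cut.
For `J = ℤ` it is `Γ_D^ℤ`, and for `J = ℤ/rℤ` it is `Γ_D^{(r)}`. -/
def cover (D : Set H) (J : Type w) [AddGroupWithOne J] : RibbonData V (H × J) where
  s x := Γ.s x.1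
  ι x := (Γ.ι x.1, x.2)
  ρ :=
    { toFun := fun x => (Γ.ρ x.1, if x.1 ∈ D then x.2 + 1 else x.2)
      invFun := fun x => (Γ.ρ.symm x.1, if Γ.ρ.symm x.1 ∈ D then x.2 - 1 else x.2)
      left_inv := fun x => by by_cases h : x.1 ∈ D <;> simp [h]
      right_inv := fun x => by by_cases h : Γ.ρ.symm x.1 ∈ D <;> simp [h] }

end RibbonData

/-! ### Gentle algebras and their ribbon graphs -/

section Gentle

open PathAlgebra

variable {k : Type w} [Field k] {Q : Type u} [Quiver.{v} Q] (I : TwoSidedIdeal (PathAlgebra k Q))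

/-- `I` is an admissible ideal: `R^m ⊆ I ⊆ R²` for some `m`, where `R^n` is spanned by the paths of
length at least `n`. -/
structure IsAdmissible : Prop where
  two_le_length : ∀ x ∈ I, ∀ p : AllPaths Q, coeff k Q x p ≠ 0 → 2 ≤ p.2.2.length
  exists_length : ∃ m : ℕ, ∀ (a b : Q) (p : Path a b), m ≤ p.length → ofPath k p ∈ I

/-- `(Q, I)` is a special biserial presentation. -/
structure IsSpecialBiserial : Prop where
  admissible : IsAdmissible I
  out_le : ∀ a : Q, ENat.card (Σ b, a ⟶ b) ≤ 2
  in_le : ∀ b : Q, ENat.card (Σ a, a ⟶ b) ≤ 2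
  out_unique : ∀ {a b : Q} (α : a ⟶ b),
    {β : Σ c, b ⟶ c | ofPath k (α.toPath.cons β.2) ∉ I}.Subsingleton
  in_unique : ∀ {a b : Q} (α : a ⟶ b),
    {γ : Σ c, c ⟶ a | ofPath k (γ.2.toPath.cons α) ∉ I}.Subsingleton

/-- `(Q, I)` is a gentle presentation, that is, `kQ/I` is a gentle algebra. -/
structure IsGentle : Prop where
  finite_vertices : Finite Q
  specialBiserial : IsSpecialBiserial I
  quadratic_monomial : ∃ S : Set (AllPaths Q), (∀ p ∈ S, p.2.2.length = 2) ∧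
    I = TwoSidedIdeal.span ((fun p => ofPath k p.2.2) '' S)
  out_relation_unique : ∀ {a b : Q} (α : a ⟶ b),
    {β : Σ c, b ⟶ c | ofPath k (α.toPath.cons β.2) ∈ I}.Subsingleton
  in_relation_unique : ∀ {a b : Q} (α : a ⟶ b),
    {γ : Σ c, c ⟶ a | ofPath k (γ.2.toPath.cons α) ∈ I}.Subsingleton

/-- The set `𝓜` of maximal paths of `kQ/I`: the nonzero paths `p` with `α p = 0 = p α` for all
arrows `α`. -/
structure IsMaximalPath {a b : Q} (p : Path a b) : Prop where
  ne_zero : ofPath k p ∉ I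
  comp_arrow : ∀ (c : Q) (α : b ⟶ c), ofPath k (p.cons α) ∈ I
  arrow_comp : ∀ (c : Q) (α : c ⟶ a), ofPath k (α.toPath.comp p) ∈ I

/-- The vertices `x` of `Q` that are added to `𝓜`: a source with a single arrow starting at `x`, a
sink with a single arrow ending at `x`, or a vertex with a single arrow `α` ending at `x` and a
single arrow `β` starting at `x`, and with `β α ∉ I`.  An isolated vertex is added as well (its
trivial path is also in `𝓜`, and its edge needs two endpoints). -/
def IsAddedVertex (x : Q) : Prop :=
  (ENat.card (Σ a, a ⟶ x) = 0 ∧ ENat.card (Σ c, x ⟶ c) = 1) ∨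
  (ENat.card (Σ a, a ⟶ x) = 1 ∧ ENat.card (Σ c, x ⟶ c) = 0) ∨
  (ENat.card (Σ a, a ⟶ x) = 1 ∧ ENat.card (Σ c, x ⟶ c) = 1 ∧
    ∀ (a c : Q) (α : a ⟶ x) (β : x ⟶ c), ofPath k (α.toPath.cons β) ∉ I) ∨
  (ENat.card (Σ a, a ⟶ x) = 0 ∧ ENat.card (Σ c, x ⟶ c) = 0)

/-- The vertices of the ribbon graph of `kQ/I`: the maximal paths and the added vertices. -/
inductive GentleVertex : Type (max u v)
  | path {a b : Q} (p : Path a b) (hp : IsMaximalPath I p)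
  | added (x : Q) (hx : IsAddedVertex I x)

/-- The half-edges of the ribbon graph of `kQ/I`: a half-edge at a maximal path is a passage of
the path through a vertex `x` of `Q`, given by the part `p` of the path before `x` and the part `q`
after `x`; at an added vertex `x` there is one half-edge. -/
inductive GentleHalfEdge : Type (max u v)
  | pass {a x b : Q} (p : Path a x) (q : Path x b) (hpq : IsMaximalPath I (p.comp q))
  | added (x : Q) (hx : IsAddedVertex I x)

/-- The decomposition of a nontrivial path into its first arrow and the rest. -/
def splitFirst {a : Q} : {b : Q} → (q : Path a b) → 0 < q.length →
    {r : Σ y, (a ⟶ y) × Path y b // r.2.1.toPath.comp r.2.2 = q}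
  | _, .cons .nil β, _ => ⟨⟨_, β, .nil⟩, rfl⟩
  | _, .cons (.cons q γ) β, _ =>
    let r := splitFirst (q.cons γ) (Nat.succ_pos _)
    ⟨⟨r.1.1, r.1.2.1, r.1.2.2.cons β⟩, by rw [Path.comp_cons, r.2]⟩

namespace GentleHalfEdge

variable {I}

/-- The vertex of `Q` (the edge of the ribbon graph) to which a half-edge belongs. -/
def point : GentleHalfEdge I → Q
  | @pass _ _ _ _ _ _ x _ _ _ _ => x
  | added x _ => x

/-- The vertex of the ribbon graph at which a half-edge is attached. -/
def vertex : GentleHalfEdge I → GentleVertex I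
  | pass p q h => .path (p.comp q) h
  | added x hx => .added x hx

theorem cons_comp_eq {a x y b : Q} (p : Path a x) {β : x ⟶ y} {q' : Path y b} {q : Path x b}
    (h : β.toPath.comp q' = q) : p.comp q = (p.cons β).comp q' := by
  rw [← h, ← Path.comp_assoc, Path.comp_toPath_eq_cons]

/-- The successor: the next passage along the maximal path, where the last passage is followed by
the first one. -/
def next : GentleHalfEdge I → GentleHalfEdge I
  | pass p .nil h => pass .nil p (by simpa using h)
  | pass p (.cons q β) h =>
    let r := splitFirst (q.cons β) (Nat.succ_pos _)
    pass (p.cons r.1.2.1) r.1.2.2 (cons_comp_eq p r.2 ▸ h)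
  | added x hx => added x hx

/-- The predecessor. -/
def prev : GentleHalfEdge I → GentleHalfEdge I
  | pass .nil q h => pass q .nil (by simpa using h)
  | pass (.cons p β) q h => pass p (β.toPath.comp q) (by
      rwa [← Path.comp_assoc, Path.comp_toPath_eq_cons])
  | added x hx => added x hx

open Classical in
/-- The other half of an edge: the other half-edge that belongs to the same vertex of `Q`. -/
def opposite (h : GentleHalfEdge I) : GentleHalfEdge I :=
  if H : ∃ h', h' ≠ h ∧ h'.point = h.point then H.choose else h

/-- The half-edges at the end of a maximal path (and at the added vertices).  The arrow `α_h` of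
such a half-edge closes the cycle at its vertex; the other arrows `α_h` are the arrows of `Q`. -/
def IsLast : GentleHalfEdge I → Prop
  | pass _ q _ => q.length = 0
  | added _ _ => True

theorem splitFirst_toPath_comp {a x b : Q} (β : a ⟶ x) (q : Path x b) :
    ∀ h, (splitFirst (β.toPath.comp q) h).1 = ⟨x, β, q⟩ := by
  induction q with
  | nil => exact fun _ => rfl
  | cons q γ ih =>
    cases q with
    | nil => exact fun _ => rfl
    | cons q δ =>
      intro h
      have := ih (by simp)
      exact congrArg (fun r : Σ y, (a ⟶ y) × Path y _ =>
        (⟨r.1, r.2.1, r.2.2.cons γ⟩ : Σ y, (a ⟶ y) × Path y _)) this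

theorem pass_congr {a x b : Q} {p p' : Path a x} {q q' : Path x b} (hp : p = p') (hq : q = q')
    (h : IsMaximalPath I (p.comp q)) (h' : IsMaximalPath I (p'.comp q')) :
    pass p q h = pass p' q' h' := by
  subst hp hq
  rfl

theorem next_pass {a x y b : Q} (p : Path a x) (β : x ⟶ y) (q : Path y b)
    (h : IsMaximalPath I (p.comp (β.toPath.comp q)))
    (h' : IsMaximalPath I ((p.cons β).comp q)) :
    (pass p (β.toPath.comp q) h).next = pass (p.cons β) q h' := by
  have key : ∀ (r r' : Σ y, (x ⟶ y) × Path y b) (_ : r = r')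
      (hr : IsMaximalPath I ((p.cons r.2.1).comp r.2.2))
      (hr' : IsMaximalPath I ((p.cons r'.2.1).comp r'.2.2)),
      pass (p.cons r.2.1) r.2.2 hr = pass (p.cons r'.2.1) r'.2.2 hr' := by
    rintro r _ rfl _ _
    rfl
  have split := splitFirst_toPath_comp β q
  have pos : 0 < (β.toPath.comp q).length := by
    rw [Path.length_comp]
    exact Nat.add_pos_left Nat.one_pos _
  generalize β.toPath.comp q = q' at h split pos
  cases q' with
  | nil => exact (Nat.lt_irrefl 0 pos).elim
  | cons q' γ => exact key _ ⟨y, β, q⟩ (split pos) _ h'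

theorem prev_next (h : GentleHalfEdge I) : h.next.prev = h := by
  match h with
  | pass p .nil h => rfl
  | pass p (.cons q β) h =>
    exact pass_congr rfl (splitFirst (q.cons β) (Nat.succ_pos _)).2 _ _
  | added x hx => rfl

theorem next_prev (h : GentleHalfEdge I) : h.prev.next = h := by
  match h with
  | pass .nil q h => rfl
  | pass (.cons p β) q h => exact next_pass p β q _ h
  | added x hx => rfl

end GentleHalfEdge

/-- The ribbon graph of `kQ/I`. -/
def gentleGraph : RibbonData (GentleVertex I) (GentleHalfEdge I) where
  s := GentleHalfEdge.vertex
  ι := GentleHalfEdge.opposite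
  ρ := ⟨GentleHalfEdge.next, GentleHalfEdge.prev, GentleHalfEdge.prev_next,
    GentleHalfEdge.next_prev⟩

/-- The cutting set that corresponds to `kQ/I`: the arrows `α_h` that are not arrows of `Q`. -/
def gentleCut : Set (GentleHalfEdge I) := {h | h.IsLast}

end Gentle

end

/-! The last arrow at a maximal path `m` closes `m` to a cycle and stands for the functional `m*` in
`DA` dual to `m`. If `m` traverses `p`, then `q`, then `r`, the walk along `r`, the closing arrow
and `p` corresponds to `p m* r = q*`. Hence walks that stay inside a maximal path give the basis of
nonzero paths of `A`, and walks that cross the cut once give the dual basis of `DA`. A full turn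
gives `e_x*`, whichever of the two half-edges at `x` it starts from: this is the commutativity
relation. At an added vertex the loop itself is `e_x*`.

The combinatorial input is that a nontrivial nonzero path lies in exactly one maximal path, at
exactly one place (`IsGentle.isMaximalPath_unique`). It yields two half-edges at each vertex of `Q`
(`IsGentle.exists_two_halfEdges`) and the zero relations
(`IsGentle.arrowImage_mul_arrowImage_eq_zero`). A full turn fixes each half-edge of `Γ` and, in a
covering, moves it to the next sheet (`cover_ρ_pow_val`); admissibility follows.

Both coverings are treated at once, with sheets in a group `J` onto which `ℤ` maps. Sheet `j`
corresponds to place `-j` of a sequence, because `f_i` is multiplied on the right by `a_{i+1}`,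
while walks raise the sheet. The fractional Brauer graph algebra is spanned by the walks of length
at most `d` (`RibbonData.span_range_runElt`). A spanning family of such walks is sent bijectively to
a basis of the finitely supported `J`-sequences (`IsGentle.exists_spanning_runs`), so the
homomorphism is injective with that image. For `J = ℤ` and `J = ℤ/r` these sequences are `Â` and
`T_r(A)`. -/

noncomputable section
open Quiver

universe u v w

/-! ### Homomorphisms out of path algebras and their quotients -/

namespace PathAlgebra

variable {k : Type w} [Field k] {Q : Type u} [Quiver.{v} Q]

open Classical in
theorem coeff_ofPath {a b : Q} (p : Path a b) (q : AllPaths Q) :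
    coeff k Q (ofPath k p) q = if q = ⟨a, b, p⟩ then 1 else 0 := by
  simp [ofPath, Finsupp.single_apply, eq_comm]

theorem ofPath_cast {a b a' b' : Q} (p : Path a b) (ha : a = a') (hb : b = b') :
    ofPath k (p.cast ha hb) = ofPath k p := by
  subst ha hb
  rfl

theorem ofPath_cons {a b c : Q} (p : Path a b) (α : b ⟶ c) :
    ofPath k (p.cons α) = ofPath k α.toPath * ofPath k p := by
  rw [ofPath_mul_ofPath, Path.comp_toPath_eq_cons]

section eval

variable {B : Type*} [NonUnitalRing B] [Module k B] [IsScalarTower k B B] [SMulCommClass k B B]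

/-- The product of the images of the arrows of a path. -/
def evalPath (e : Q → B) (g : ∀ a b : Q, (a ⟶ b) → B) {a : Q} : {b : Q} → Path a b → B
  | _, .nil => e a
  | _, .cons p α => g _ _ α * evalPath e g p

variable {e : Q → B} {g : ∀ a b : Q, (a ⟶ b) → B}

theorem mul_evalPath (he : ∀ a, e a * e a = e a) (hl : ∀ a b α, e b * g a b α = g a b α)
    {a b : Q} (p : Path a b) : e b * evalPath e g p = evalPath e g p := by
  cases p with
  | nil => exact he a
  | cons p α => rw [evalPath, ← mul_assoc, hl]

/-- The trivial path at the start contributes a factor `e a` on the right, so no condition on `g α *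
e a` is needed. The price is that an arrow evaluates to `g α * e a` rather than `g α`. -/
theorem evalPath_mul (he : ∀ a, e a * e a = e a) {a b : Q} (p : Path a b) :
    evalPath e g p * e a = evalPath e g p := by
  induction p with
  | nil => exact he a
  | cons p α ih => rw [evalPath, mul_assoc, ih]

theorem evalPath_comp (he : ∀ a, e a * e a = e a) (hl : ∀ a b α, e b * g a b α = g a b α)
    {a b c : Q} (p : Path a b) (q : Path b c) :
    evalPath e g (p.comp q) = evalPath e g q * evalPath e g p := by
  induction q with
  | nil => exact (mul_evalPath he hl p).symm
  | cons q α ih => rw [Path.comp_cons, evalPath, evalPath, ih, mul_assoc]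

/-- The universal property of the path algebra. -/
def evalHom (e : Q → B) (g : ∀ a b : Q, (a ⟶ b) → B) (he : ∀ a, e a * e a = e a)
    (hne : ∀ a b, a ≠ b → e a * e b = 0) (hl : ∀ a b α, e b * g a b α = g a b α) :
    PathAlgebra k Q →ₙₐ[k] B :=
  let f : PathAlgebra k Q →ₗ[k] B :=
    Finsupp.lift B k (AllPaths Q) (fun p => evalPath e g p.2.2) ∘ₗ (coeff k Q).toLinearMap
  have hf : ∀ {a b : Q} (p : Path a b), f (ofPath k p) = evalPath e g p := fun p => by
    simp [f, ofPath]
  { f with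
    map_zero' := map_zero f
    map_mul' := fun x y => by
      change f (x * y) = f x * f y
      induction x using induction_paths with
      | zero => simp
      | add x x' hx hx' => simp only [add_mul, map_add, hx, hx']
      | smul c a b p =>
        induction y using induction_paths with
        | zero => simp
        | add y y' hy hy' => simp only [mul_add, map_add, hy, hy']
        | smul c' a' b' q =>
          simp only [map_smul, smul_mul_assoc, mul_smul_comm, hf]
          congr 2
          by_cases h : b' = a
          · subst h
            rw [ofPath_mul_ofPath, hf, evalPath_comp he hl]
          · rw [ofPath_mul_ofPath_of_ne _ _ h, map_zero, ← evalPath_mul he p,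
              ← mul_evalPath he hl q, mul_assoc, ← mul_assoc (e a), hne _ _ (Ne.symm h), zero_mul,
              mul_zero] }

theorem evalHom_ofPath (he : ∀ a, e a * e a = e a)
    (hne : ∀ a b, a ≠ b → e a * e b = 0) (hl : ∀ a b α, e b * g a b α = g a b α)
    {a b : Q} (p : Path a b) :
    evalHom (k := k) e g he hne hl (ofPath k p) = evalPath e g p := by
  change (Finsupp.lift B k (AllPaths Q) (fun p => evalPath e g p.2.2) ∘ₗ
    (coeff k Q).toLinearMap) (ofPath k p) = _
  simp [ofPath]

end eval

end PathAlgebra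

namespace BoundQuiverAlgebra

variable {k : Type w} [Field k] {Q : Type u} [Quiver.{v} Q] (I : TwoSidedIdeal (PathAlgebra k Q))

theorem mk_eq_zero {x : PathAlgebra k Q} : mk I x = 0 ↔ x ∈ I := by
  rw [← mk_zero, mk_eq_mk, sub_zero]

/-- Elements of `kQ/I` are linear combinations of paths. -/
theorem span_range_ofPath :
    Submodule.span k (Set.range fun p : AllPaths Q => mk I (PathAlgebra.ofPath k p.2.2)) = ⊤ := by
  rw [eq_top_iff]
  rintro x -
  obtain ⟨x, rfl⟩ := mk_surjective I x
  induction x using PathAlgebra.induction_paths with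
  | zero => exact zero_mem _
  | add x y hx hy => exact add_mem hx hy
  | smul c a b p =>
    exact Submodule.smul_mem _ c
      (Submodule.subset_span (Set.mem_range_self (⟨a, b, p⟩ : AllPaths Q)))

variable {I}

/-- A linear map that vanishes on `I` factors through `kQ/I`. -/
def liftₗ {M : Type*} [AddCommGroup M] [Module k M] (f : PathAlgebra k Q →ₗ[k] M)
    (hf : ∀ x ∈ I, f x = 0) : BoundQuiverAlgebra I →ₗ[k] M where
  toFun := Quotient.lift f fun x y h => by
    rw [← sub_eq_zero, ← map_sub]
    exact hf _ ((I.rel_iff x y).1 h)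
  map_add' x y := by
    obtain ⟨x, rfl⟩ := mk_surjective I x
    obtain ⟨y, rfl⟩ := mk_surjective I y
    exact map_add f x y
  map_smul' c x := by
    obtain ⟨x, rfl⟩ := mk_surjective I x
    exact map_smul f c x

/-- An algebra homomorphism that vanishes on `I` factors through `kQ/I`. -/
def lift {B : Type*} [NonUnitalRing B] [Module k B] (f : PathAlgebra k Q →ₙₐ[k] B)
    (hf : ∀ x ∈ I, f x = 0) : BoundQuiverAlgebra I →ₙₐ[k] B where
  toFun := liftₗ (f : PathAlgebra k Q →ₗ[k] B) hf
  map_smul' c x := map_smul (liftₗ (f : PathAlgebra k Q →ₗ[k] B) hf) c x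
  map_zero' := map_zero _
  map_add' := map_add _
  map_mul' x y := by
    obtain ⟨x, rfl⟩ := mk_surjective I x
    obtain ⟨y, rfl⟩ := mk_surjective I y
    exact map_mul f x y

end BoundQuiverAlgebra

/-! ### Runs span the algebra of an admissible fractional Brauer graph -/

namespace RibbonData

open PathAlgebra

variable {V : Type u} {H : Type v} (Γ : RibbonData V H) (k : Type w) [Field k]

theorem edge_ι (h : H) : Γ.edge (Γ.ι h) = Γ.edge h :=
  Eq.symm <| Quot.sound (r := fun h h' : H => Γ.ι h = h') rfl

-- The relation that defines edges is not assumed to be an equivalence; since `ι` is an involution,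
-- the equivalence it generates has classes `{h, ι h}`.
variable {Γ} in
theorem IsRibbonGraph.edge_eq_iff (hΓ : Γ.IsRibbonGraph) {h h' : H} :
    Γ.edge h = Γ.edge h' ↔ h' = h ∨ h' = Γ.ι h := by
  constructor
  · intro H
    have := Quot.eqvGen_exact H
    induction this with
    | rel x y hxy => exact .inr hxy.symm
    | refl x => exact .inl rfl
    | symm x y _ ih =>
      obtain rfl | rfl := ih (Quot.eqvGen_sound ‹_›)
      · exact .inl rfl
      · exact .inr (hΓ.involutive x).symm
    | trans x y z _ _ ih ih' =>
      obtain rfl | rfl := ih (Quot.eqvGen_sound ‹_›)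
      · exact ih' (Quot.eqvGen_sound ‹_›)
      · obtain rfl | rfl := ih' (Quot.eqvGen_sound ‹_›)
        · exact .inr rfl
        · exact .inl (hΓ.involutive x)
  · rintro (rfl | rfl)
    · rfl
    · exact (Γ.edge_ι h).symm

/-- The ideal `I_{Γ,d}`. -/
abbrev relationIdeal (d : V → ℕ) : TwoSidedIdeal (PathAlgebra k Γ.Edge) :=
  TwoSidedIdeal.span {x | Γ.Relation k d x}

/-- The arrow `α_h`, as an element of the path algebra. -/
def arrowElt (h : H) : PathAlgebra k Γ.Edge := ofPath k (Γ.arrow h).toPath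

/-- The path `run h n`, as an element of the path algebra. -/
def runElt (h : H) (n : ℕ) : PathAlgebra k Γ.Edge := ofPath k (Γ.run h n)

theorem runElt_zero (h : H) : Γ.runElt k h 0 = ofPath k (Path.nil : Path (Γ.edge h) _) := rfl

theorem runElt_succ (h : H) (n : ℕ) :
    Γ.runElt k h (n + 1) = Γ.arrowElt k ((Γ.ρ ^ n) h) * Γ.runElt k h n := by
  rw [runElt, run, ofPath_cast, ofPath_cons, runElt, arrowElt]

theorem nil_mul_runElt (h h' : H) (n : ℕ) (hh : h' = (Γ.ρ ^ n) h) :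
    Γ.runElt k h' 0 * Γ.runElt k h n = Γ.runElt k h n := by
  subst hh
  exact ofPath_mul_ofPath Path.nil (Γ.run h n)

theorem runElt_add (h : H) (n m : ℕ) :
    Γ.runElt k h (n + m) = Γ.runElt k ((Γ.ρ ^ n) h) m * Γ.runElt k h n := by
  induction m with
  | zero => exact (Γ.nil_mul_runElt k h _ n rfl).symm
  | succ m ih =>
    rw [← add_assoc, runElt_succ, ih, runElt_succ, ← Equiv.Perm.mul_apply, ← pow_add,
      add_comm m n, mul_assoc]

theorem runElt_one (h : H) : Γ.runElt k h 1 = Γ.arrowElt k h := by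
  rw [runElt_succ, runElt_zero]
  exact ofPath_mul_ofPath _ _

theorem runElt_zero_congr {h h' : H} (e : Γ.edge h = Γ.edge h') :
    Γ.runElt k h 0 = Γ.runElt k h' 0 := by
  rw [runElt_zero, runElt_zero, e]

variable {Γ} {d : V → ℕ}

theorem runElt_sub_runElt_mem {h h' : H} (e : Γ.edge h = Γ.edge h') :
    Γ.runElt k h (d (Γ.s h)) - Γ.runElt k h' (d (Γ.s h')) ∈ Γ.relationIdeal k d :=
  TwoSidedIdeal.subset_span (Relation.commutativity h h' e)

theorem arrow_mul_runElt_mem {h h' : H} {n : ℕ}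
    (e : Γ.edge ((Γ.ρ ^ (n + 1)) h) = Γ.edge h') (hne : (Γ.ρ ^ (n + 1)) h ≠ h') :
    Γ.arrowElt k h' * Γ.runElt k h (n + 1) ∈ Γ.relationIdeal k d := by
  rw [runElt_succ, ← mul_assoc]
  refine TwoSidedIdeal.mul_mem_right _ _ _ (TwoSidedIdeal.subset_span ?_)
  rw [pow_succ'] at e hne
  exact Relation.zero _ h' e hne

/-- Modulo the ideal, the first `d` arrows can be replaced by the full run from `ι h`. As `ι`
commutes with the Nakayama automorphism, that run ends at the other half of the edge, so the next
arrow is not its successor and the product is a zero relation. -/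
theorem runElt_mem_of_lt (hd : Γ.IsAFBG d) (h : H) {n : ℕ} (hn : d (Γ.s h) < n) :
    Γ.runElt k h n ∈ Γ.relationIdeal k d := by
  obtain ⟨m, rfl⟩ := Nat.exists_eq_add_of_lt hn
  rw [add_right_comm, runElt_add]
  refine TwoSidedIdeal.mul_mem_left _ _ _ ?_
  rw [runElt_succ]
  have h1 := TwoSidedIdeal.mul_mem_left _ (Γ.arrowElt k ((Γ.ρ ^ d (Γ.s h)) h)) _
    (runElt_sub_runElt_mem k (d := d) (Γ.edge_ι h).symm)
  rw [mul_sub] at h1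
  have h2 : Γ.arrowElt k ((Γ.ρ ^ d (Γ.s h)) h) *
      Γ.runElt k (Γ.ι h) (d (Γ.s (Γ.ι h))) ∈ Γ.relationIdeal k d := by
    -- Positive degree ensures that the run from `ι h` has a last arrow to which the zero relation
    -- applies.
    obtain ⟨m, hm⟩ := Nat.exists_eq_succ_of_ne_zero (hd.degree_pos (Γ.s (Γ.ι h))).ne'
    have key := hd.ι_nakayama h
    rw [hm] at key ⊢
    rw [Nat.succ_eq_add_one] at *
    refine arrow_mul_runElt_mem k ?_ ?_
    · rw [← key, edge_ι]
    · rw [← key]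
      exact hd.isRibbonGraph.ι_ne _
  simpa using TwoSidedIdeal.add_mem _ h1 h2

/-- A path of `Q_Γ` is a run or lies in the ideal. -/
theorem exists_runElt (a b : Γ.Edge) (p : Path a b) :
    ofPath k p ∈ Γ.relationIdeal k d ∨
      ∃ h n, b = Γ.edge ((Γ.ρ ^ n) h) ∧ ofPath k p = Γ.runElt k h n := by
  induction p with
  | nil =>
    obtain ⟨h, rfl⟩ := Quot.exists_rep a
    exact .inr ⟨h, 0, rfl, rfl⟩
  | @cons b c p α ih =>
    obtain ⟨h', rfl, rfl⟩ := α
    rw [ofPath_cons]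
    rcases ih with ih | ⟨h, n, hb, hp⟩
    · exact .inl (TwoSidedIdeal.mul_mem_left _ _ _ ih)
    · change Γ.arrowElt k h' * _ ∈ _ ∨ ∃ h n, _ ∧ Γ.arrowElt k h' * _ = _
      rw [hp]
      by_cases hh : (Γ.ρ ^ n) h = h'
      · subst hh
        exact .inr ⟨h, n + 1, by rw [pow_succ']; rfl, by rw [runElt_succ]⟩
      · cases n with
        -- The trivial path was attributed to an arbitrary half of its edge; it is reattributed to
        -- the half `h'` whose arrow comes next.
        | zero =>
          refine .inr ⟨h', 1, rfl, ?_⟩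
          rw [Γ.runElt_zero_congr k (h := h) (h' := h') hb.symm, runElt_succ]
          rfl
        | succ n => exact .inl (arrow_mul_runElt_mem k hb.symm hh)

/-- The algebra of an admissible fractional Brauer graph is spanned by the runs `run h n` with
`n ≤ d (s h)`. -/
theorem span_range_runElt (hd : Γ.IsAFBG d) :
    Submodule.span k {x : Γ.AFBGA k d | ∃ h n, n ≤ d (Γ.s h) ∧
      x = BoundQuiverAlgebra.mk (Γ.relationIdeal k d) (Γ.runElt k h n)} = ⊤ := by
  rw [eq_top_iff, ← BoundQuiverAlgebra.span_range_ofPath, Submodule.span_le]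
  rintro _ ⟨⟨a, b, p⟩, rfl⟩
  have key : BoundQuiverAlgebra.mk (Γ.relationIdeal k d) (ofPath k p) = 0 ∨ ∃ h n, n ≤ d (Γ.s h) ∧
      BoundQuiverAlgebra.mk (Γ.relationIdeal k d) (ofPath k p) =
        BoundQuiverAlgebra.mk (Γ.relationIdeal k d) (Γ.runElt k h n) := by
    rw [BoundQuiverAlgebra.mk_eq_zero]
    rcases exists_runElt (d := d) k a b p with hp | ⟨h, n, -, hp⟩
    · exact .inl hp
    · rw [hp]
      rcases lt_or_ge (d (Γ.s h)) n with hn | hn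
      · exact .inl (runElt_mem_of_lt k hd h hn)
      · exact .inr ⟨h, n, hn, rfl⟩
  rcases key with key | key
  · simp only [key, SetLike.mem_coe, zero_mem]
  · exact Submodule.subset_span key

end RibbonData

end

/-! ### Coefficients of products with a path -/

noncomputable section
open Quiver

universe u v w

namespace PathAlgebra

variable {k : Type w} [Field k] {Q : Type u} [Quiver.{v} Q]

theorem coeff_ofPath_mul {a b c : Q} (q : Path b c) (x : PathAlgebra k Q) (p : Path a b) :
    coeff k Q (ofPath k q * x) ⟨a, c, p.comp q⟩ = coeff k Q x ⟨a, b, p⟩ := by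
  induction x using induction_paths with
  | zero => simp
  | add x y hx hy => simp only [mul_add, map_add, Finsupp.add_apply, hx, hy]
  | smul t a' b' p' =>
    simp only [mul_smul', map_smul, Finsupp.smul_apply]
    congr 1
    classical
    by_cases h : b' = b
    · subst h
      rw [ofPath_mul_ofPath, coeff_ofPath, coeff_ofPath]
      congr 1
      refine propext ⟨fun e => ?_, fun e => ?_⟩
      · obtain rfl := (Sigma.mk.inj e).1
        have := eq_of_heq (Sigma.mk.inj (eq_of_heq (Sigma.mk.inj e).2)).2
        rw [Path.comp_injective_left _ this]
      · obtain rfl := (Sigma.mk.inj e).1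
        have := eq_of_heq (Sigma.mk.inj (eq_of_heq (Sigma.mk.inj e).2)).2
        rw [this]
    · rw [ofPath_mul_ofPath_of_ne _ _ h, coeff_ofPath, if_neg]
      · simp
      · intro e
        obtain rfl := (Sigma.mk.inj e).1
        exact h (Sigma.mk.inj (eq_of_heq (Sigma.mk.inj e).2)).1.symm

theorem coeff_ofPath_mul_eq_zero {b c : Q} (q : Path b c) (x : PathAlgebra k Q)
    (r : AllPaths Q) (hr : ∀ (a : Q) (p : Path a b), r ≠ ⟨a, c, p.comp q⟩) :
    coeff k Q (ofPath k q * x) r = 0 := by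
  induction x using induction_paths with
  | zero => simp
  | add x y hx hy => simp only [mul_add, map_add, Finsupp.add_apply, hx, hy, add_zero]
  | smul t a' b' p' =>
    simp only [mul_smul', map_smul, Finsupp.smul_apply]
    by_cases h : b' = b
    · subst h
      rw [ofPath_mul_ofPath, coeff_ofPath, if_neg (hr _ _), smul_zero]
    · rw [ofPath_mul_ofPath_of_ne _ _ h]
      simp

theorem coeff_mul_ofPath {a b c : Q} (p : Path a b) (x : PathAlgebra k Q) (q : Path b c) :
    coeff k Q (x * ofPath k p) ⟨a, c, p.comp q⟩ = coeff k Q x ⟨b, c, q⟩ := by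
  induction x using induction_paths with
  | zero => simp
  | add x y hx hy => simp only [add_mul, map_add, Finsupp.add_apply, hx, hy]
  | smul t b' c' q' =>
    simp only [smul_mul', map_smul, Finsupp.smul_apply]
    congr 1
    classical
    by_cases h : b = b'
    · subst h
      rw [ofPath_mul_ofPath, coeff_ofPath, coeff_ofPath]
      congr 1
      refine propext ⟨fun e => ?_, fun e => ?_⟩
      · have := Sigma.mk.inj (eq_of_heq (Sigma.mk.inj e).2)
        obtain rfl := this.1
        rw [Path.comp_injective_right _ (eq_of_heq this.2)]
      · have := Sigma.mk.inj (eq_of_heq (Sigma.mk.inj e).2)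
        obtain rfl := this.1
        rw [eq_of_heq this.2]
    · rw [ofPath_mul_ofPath_of_ne _ _ h, coeff_ofPath, if_neg]
      · simp
      · exact fun e => h (Sigma.mk.inj e).1

theorem coeff_mul_ofPath_eq_zero {a b : Q} (p : Path a b) (x : PathAlgebra k Q)
    (r : AllPaths Q) (hr : ∀ (c : Q) (q : Path b c), r ≠ ⟨a, c, p.comp q⟩) :
    coeff k Q (x * ofPath k p) r = 0 := by
  induction x using induction_paths with
  | zero => simp
  | add x y hx hy => simp only [add_mul, map_add, Finsupp.add_apply, hx, hy, add_zero]
  | smul t b' c' q' =>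
    simp only [smul_mul', map_smul, Finsupp.smul_apply]
    by_cases h : b = b'
    · subst h
      rw [ofPath_mul_ofPath, coeff_ofPath, if_neg (hr _ _), smul_zero]
    · rw [ofPath_mul_ofPath_of_ne _ _ h]
      simp

end PathAlgebra

open PathAlgebra

variable {k : Type w} [Field k] {Q : Type u} [Quiver.{v} Q]

/-! ### Membership in the ideal, and maximal paths -/

section

variable (I : TwoSidedIdeal (PathAlgebra k Q))

/-- No two consecutive arrows of the path form a path in `I`. -/
def AvoidsRelations {a : Q} : {b : Q} → Path a b → Prop
  | _, .nil => True
  | _, .cons .nil _ => True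
  | _, .cons (.cons p α) β => AvoidsRelations (p.cons α) ∧ ofPath k (α.toPath.cons β) ∉ I

variable {I}

theorem AvoidsRelations.of_cons {a b c : Q} {p : Path a b} {α : b ⟶ c}
    (h : AvoidsRelations I (p.cons α)) : AvoidsRelations I p := by
  cases p with
  | nil => trivial
  | cons p β => exact h.1

theorem AvoidsRelations.of_comp_left {a b c : Q} {p : Path a b} {q : Path b c}
    (h : AvoidsRelations I (p.comp q)) : AvoidsRelations I p := by
  induction q with
  | nil => exact h
  | cons q α ih => exact ih h.of_cons

theorem AvoidsRelations.of_comp_right {a b c : Q} {p : Path a b} {q : Path b c}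
    (h : AvoidsRelations I (p.comp q)) : AvoidsRelations I q := by
  induction q with
  | nil => trivial
  | cons q α ih =>
    cases q with
    | nil => trivial
    | cons q β => exact ⟨ih h.1, h.2⟩

theorem mem_of_not_avoidsRelations {a b : Q} (p : Path a b) (h : ¬ AvoidsRelations I p) :
    ofPath k p ∈ I := by
  induction p with
  | nil => exact (h trivial).elim
  | cons p α ih =>
    rw [ofPath_cons]
    cases p with
    | nil => exact (h trivial).elim
    | cons p β =>
      by_cases h' : AvoidsRelations I (p.cons β)
      · have : ofPath k (β.toPath.cons α) ∈ I := by
          by_contra h''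
          exact h ⟨h', h''⟩
        rw [ofPath_cons, ← mul_assoc]
        rw [ofPath_cons] at this
        exact TwoSidedIdeal.mul_mem_right _ _ _ this
      · exact TwoSidedIdeal.mul_mem_left _ _ _ (ih h')

theorem ofPath_mem_of_left {a b c : Q} {p : Path a b} {q : Path b c} (h : ofPath k p ∈ I) :
    ofPath k (p.comp q) ∈ I := by
  rw [← ofPath_mul_ofPath]
  exact TwoSidedIdeal.mul_mem_left _ _ _ h

theorem ofPath_mem_of_right {a b c : Q} {p : Path a b} {q : Path b c} (h : ofPath k q ∈ I) :
    ofPath k (p.comp q) ∈ I := by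
  rw [← ofPath_mul_ofPath]
  exact TwoSidedIdeal.mul_mem_right _ _ _ h

namespace IsGentle

variable (hI : IsGentle I)
include hI

/-- The span of the paths that contain a relation is stable under multiplication on both sides, and
it contains the generators, which are themselves paths of length two in `I`. -/
theorem mem_span_of_mem {x : PathAlgebra k Q} (hx : x ∈ I) :
    x ∈ Submodule.span k {x | ∃ (a b : Q) (p : Path a b), ¬ AvoidsRelations I p ∧
      x = ofPath k p} := by
  have hmul : ∀ x y, y ∈ Submodule.span k {x | ∃ (a b : Q) (p : Path a b),
      ¬ AvoidsRelations I p ∧ x = ofPath k p} →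
      x * y ∈ Submodule.span k {x | ∃ (a b : Q) (p : Path a b),
        ¬ AvoidsRelations I p ∧ x = ofPath k p} ∧
      y * x ∈ Submodule.span k {x | ∃ (a b : Q) (p : Path a b),
        ¬ AvoidsRelations I p ∧ x = ofPath k p} := by
    intro x y hy
    induction hy using Submodule.span_induction with
    | zero => simp
    | add y z _ _ hy hz =>
      rw [mul_add, add_mul]
      exact ⟨add_mem hy.1 hz.1, add_mem hy.2 hz.2⟩
    | smul c y _ hy =>
      rw [mul_smul', PathAlgebra.smul_mul']
      exact ⟨Submodule.smul_mem _ _ hy.1, Submodule.smul_mem _ _ hy.2⟩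
    | mem y hy =>
      obtain ⟨a, b, p, hp, rfl⟩ := hy
      induction x using induction_paths with
      | zero => simp
      | add y z hy hz =>
        rw [mul_add, add_mul]
        exact ⟨add_mem hy.1 hz.1, add_mem hy.2 hz.2⟩
      | smul c a' b' q =>
        rw [mul_smul', PathAlgebra.smul_mul']
        constructor
        · refine Submodule.smul_mem _ _ ?_
          by_cases h : b = a'
          · subst h
            rw [ofPath_mul_ofPath]
            exact Submodule.subset_span ⟨_, _, _, fun h => hp h.of_comp_left, rfl⟩
          · rw [ofPath_mul_ofPath_of_ne _ _ h]
            exact zero_mem _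
        · refine Submodule.smul_mem _ _ ?_
          by_cases h : b' = a
          · subst h
            rw [ofPath_mul_ofPath]
            exact Submodule.subset_span ⟨_, _, _, fun h => hp h.of_comp_right, rfl⟩
          · rw [ofPath_mul_ofPath_of_ne _ _ h]
            exact zero_mem _
  obtain ⟨S, hS, hIS⟩ := hI.quadratic_monomial
  rw [hIS] at hx
  induction hx using TwoSidedIdeal.span_induction with
  | mem x hxS =>
    obtain ⟨⟨a, b, p⟩, hxS, rfl⟩ := hxS
    refine Submodule.subset_span ⟨a, b, p, fun h => ?_, rfl⟩
    have := hS _ hxS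
    have hmem : ofPath k p ∈ I := by
      rw [hIS]
      exact TwoSidedIdeal.subset_span ⟨_, hxS, rfl⟩
    match p, this, h, hmem with
    | .cons (.cons .nil α) β, _, h, hmem => exact h.2 hmem
  | zero => exact zero_mem _
  | add x y hx hy ihx ihy => exact add_mem ihx ihy
  | neg x hx ihx => exact neg_mem ihx
  | left_absorb a x hx ihx => exact (hmul _ _ ihx).1
  | right_absorb a x hx ihx => exact (hmul _ _ ihx).2

theorem coeff_eq_zero_of_avoidsRelations {x : PathAlgebra k Q} (hx : x ∈ I) {a b : Q}
    (p : Path a b) (hp : AvoidsRelations I p) : coeff k Q x ⟨a, b, p⟩ = 0 := by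
  replace hx := hI.mem_span_of_mem hx
  induction hx using Submodule.span_induction with
  | zero => simp
  | add y z _ _ hy hz => simp [hy, hz]
  | smul c y _ hy => simp [hy]
  | mem y hy =>
    obtain ⟨a', b', q, hq, rfl⟩ := hy
    rw [coeff_ofPath, if_neg]
    rintro ⟨⟩
    exact hq hp

/-- Because `I` is quadratic monomial, vanishing of a path is a local condition on pairs of
consecutive arrows. -/
theorem ofPath_mem_iff {a b : Q} (p : Path a b) : ofPath k p ∈ I ↔ ¬ AvoidsRelations I p := by
  refine ⟨fun h h' => ?_, mem_of_not_avoidsRelations p⟩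
  have := hI.coeff_eq_zero_of_avoidsRelations h p h'
  rw [coeff_ofPath, if_pos rfl] at this
  exact one_ne_zero this

theorem coeff_eq_zero {x : PathAlgebra k Q} (hx : x ∈ I) {a b : Q}
    (p : Path a b) (hp : ofPath k p ∉ I) : coeff k Q x ⟨a, b, p⟩ = 0 :=
  hI.coeff_eq_zero_of_avoidsRelations hx p (by simpa [hI.ofPath_mem_iff] using hp)

theorem nil_notMem (a : Q) : ofPath k (Path.nil : Path a a) ∉ I := by
  rw [hI.ofPath_mem_iff, not_not]
  trivial

theorem toPath_notMem {a b : Q} (α : a ⟶ b) : ofPath k α.toPath ∉ I := by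
  rw [hI.ofPath_mem_iff, not_not]
  trivial

/-- A path is nonzero if it is glued from two nonzero paths along a nontrivial path. -/
theorem comp_comp_notMem {a b c d : Q} {p : Path a b} {q : Path b c} {r : Path c d}
    (hq : 0 < q.length) (hpq : ofPath k (p.comp q) ∉ I) (hqr : ofPath k (q.comp r) ∉ I) :
    ofPath k (p.comp (q.comp r)) ∉ I := by
  rw [hI.ofPath_mem_iff, not_not] at *
  induction r with
  | nil => exact hpq
  | cons r β ih =>
    have ih := ih hqr.of_cons
    rw [Path.comp_cons, Path.comp_cons]
    rw [Path.comp_cons] at hqr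
    -- As `q` is nontrivial, the arrow before `β` lies in `q.comp r`, so the only new pair of arrows
    -- already occurs there.
    have hpos : 0 < (q.comp r).length := by
      rw [Path.length_comp]
      omega
    generalize q.comp r = q' at *
    cases q' with
    | nil => exact (Nat.lt_irrefl 0 hpos).elim
    | cons q' α => exact ⟨ih, hqr.2⟩

theorem exists_length_lt : ∃ m : ℕ, ∀ (a b : Q) (p : Path a b), ofPath k p ∉ I → p.length < m := by
  obtain ⟨m, hm⟩ := hI.specialBiserial.admissible.exists_length
  exact ⟨m, fun a b p hp => by_contra fun h => hp (hm a b p (not_lt.1 h))⟩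

/-- Every nonzero path is part of a maximal path. -/
theorem exists_isMaximalPath {x y : Q} (p : Path x y) (hp : ofPath k p ∉ I) :
    ∃ (a b : Q) (q : Path a x) (r : Path y b), IsMaximalPath I (q.comp (p.comp r)) := by
  obtain ⟨m, hm⟩ := hI.exists_length_lt
  -- Extend at either end as long as possible; the induction is on the room left below the bound `m`
  -- on lengths of nonzero paths.
  suffices ∀ n (a b : Q) (q : Path a x) (r : Path y b), ofPath k (q.comp (p.comp r)) ∉ I →
      m - (q.comp (p.comp r)).length = n →
      ∃ (a b : Q) (q : Path a x) (r : Path y b), IsMaximalPath I (q.comp (p.comp r)) from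
    this _ x y .nil .nil (by simpa using hp) rfl
  intro n
  induction n using Nat.strong_induction_on with
  | _ n ih =>
    intro a b q r hqr hn
    have hlt := hm _ _ _ hqr
    by_cases h1 : ∃ (c : Q) (α : b ⟶ c), ofPath k ((q.comp (p.comp r)).cons α) ∉ I
    · obtain ⟨c, α, hα⟩ := h1
      refine ih _ ?_ a c q (r.cons α) hα rfl
      rw [Path.comp_cons, Path.comp_cons, Path.length_cons]
      omega
    · by_cases h2 : ∃ (c : Q) (α : c ⟶ a), ofPath k (α.toPath.comp (q.comp (p.comp r))) ∉ I
      · obtain ⟨c, α, hα⟩ := h2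
        refine ih _ ?_ c b (α.toPath.comp q) r (by rwa [Path.comp_assoc]) rfl
        rw [Path.comp_assoc, Path.length_comp, Path.length_toPath]
        omega
      · push Not at h1 h2
        exact ⟨a, b, q, r, hqr, h1, h2⟩

/-- A nonzero nontrivial path has at most one nonzero continuation by an arrow, so two continuations
of `v` agree arrow by arrow; the one that cannot be prolonged does not stop first. Nontriviality of
`v` provides the last arrow that determines the next. -/
theorem exists_comp_eq_of_forall_cons_mem {x y b b' : Q} {v : Path x y} (hv : 0 < v.length)
    {w : Path y b} {w' : Path y b'}
    (hw : ∀ (c : Q) (β : b ⟶ c), ofPath k ((v.comp w).cons β) ∈ I)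
    (hvw : ofPath k (v.comp w) ∉ I) (hvw' : ofPath k (v.comp w') ∉ I) :
    ∃ z : Path b' b, w = w'.comp z := by
  induction w' with
  | nil => exact ⟨w, (Path.nil_comp w).symm⟩
  | @cons b' c' w' β ih =>
    obtain ⟨z, rfl⟩ := ih (fun h => hvw' (by
      rw [← Path.comp_toPath_eq_cons, ← Path.comp_assoc]; exact ofPath_mem_of_left h))
    by_cases hz : z.length = 0
    · obtain rfl := Path.eq_of_length_zero z hz
      obtain rfl := Path.eq_nil_of_length_zero z hz
      exact (hvw' (hw _ β)).elim
    · obtain ⟨d, γ, z, rfl, -⟩ := (Path.length_ne_zero_iff_eq_comp z).1 hz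
      have hpos : 0 < (v.comp w').length := by
        rw [Path.length_comp]
        omega
      rw [← Path.comp_assoc, ← Path.comp_assoc] at hvw
      rw [Path.comp_cons] at hvw'
      have hvw := fun h => hvw (ofPath_mem_of_left h)
      have : (⟨_, β⟩ : Σ c, b' ⟶ c) = ⟨_, γ⟩ := by
        generalize v.comp w' = q at *
        cases q with
        | nil => exact (Nat.lt_irrefl 0 hpos).elim
        | cons q α =>
          refine hI.specialBiserial.out_unique α (fun h => hvw' ?_) (fun h => hvw ?_)
          · have := ofPath_mem_of_right (p := q) h
            rwa [Path.comp_cons, Path.comp_toPath_eq_cons] at this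
          · have := ofPath_mem_of_right (p := q) h
            rwa [Path.comp_cons, Path.comp_toPath_eq_cons, ← Path.comp_toPath_eq_cons _ γ] at this
      cases this
      exact ⟨z, by rw [← Path.comp_assoc, Path.comp_toPath_eq_cons]⟩

/-- The mirror image: arrows are compared going backwards from `v`. Since `cons` removes the arrow
adjacent to `v`, that arrow is moved into `v` for the induction. -/
theorem exists_comp_eq_of_forall_comp_mem {x y a a' : Q} {v : Path x y} (hv : 0 < v.length)
    {u : Path a x} {u' : Path a' x}
    (hu : ∀ (c : Q) (α : c ⟶ a), ofPath k (α.toPath.comp (u.comp v)) ∈ I)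
    (huv : ofPath k (u.comp v) ∉ I) (huv' : ofPath k (u'.comp v) ∉ I) :
    ∃ z : Path a a', u = z.comp u' := by
  induction u' generalizing y with
  | nil => exact ⟨u, rfl⟩
  | @cons x' x u' α' ih =>
    obtain ⟨d, β, v, rfl, -⟩ := (Path.length_ne_zero_iff_eq_comp v).1 hv.ne'
    rw [← Path.comp_toPath_eq_cons, Path.comp_assoc] at huv'
    cases u with
    | nil =>
      refine (huv' (ofPath_mem_of_right ?_)).elim
      simpa using hu _ α'
    | @cons x'' _ u α =>
      rw [← Path.comp_toPath_eq_cons, Path.comp_assoc] at huv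
      have : (⟨_, α⟩ : Σ c, c ⟶ x) = ⟨_, α'⟩ := by
        refine hI.specialBiserial.in_unique β (fun h => huv ?_) (fun h => huv' ?_)
        · refine ofPath_mem_of_right ?_
          rw [← Path.comp_assoc]
          exact ofPath_mem_of_left h
        · refine ofPath_mem_of_right ?_
          rw [← Path.comp_assoc]
          exact ofPath_mem_of_left h
      cases this
      obtain ⟨z, rfl⟩ := ih (v := α'.toPath.comp (β.toPath.comp v))
        (by rw [Path.length_comp, Path.length_toPath]; omega)
        (fun c γ => by
          have := hu c γ
          rwa [← Path.comp_toPath_eq_cons, Path.comp_assoc] at this) huv huv'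
      exact ⟨z, rfl⟩

/-- The maximal path that extends a given nontrivial path is unique. -/
theorem isMaximalPath_unique {x y a a' b b' : Q} {v : Path x y} (hv : 0 < v.length)
    {u : Path a x} {u' : Path a' x} {w : Path y b} {w' : Path y b'}
    (h : IsMaximalPath I (u.comp (v.comp w))) (h' : IsMaximalPath I (u'.comp (v.comp w'))) :
    (⟨a, u⟩ : Σ a, Path a x) = ⟨a', u'⟩ ∧ (⟨b, w⟩ : Σ b, Path y b) = ⟨b', w'⟩ := by
  have key : ∀ {a a' b b' : Q} {u : Path a x} {u' : Path a' x} {w : Path y b} {w' : Path y b'},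
      IsMaximalPath I (u.comp (v.comp w)) → IsMaximalPath I (u'.comp (v.comp w')) →
      (∃ z : Path a a', u = z.comp u') ∧ ∃ z : Path b' b, w = w'.comp z := by
    intro a a' b b' u u' w w' h h'
    have hpos : 0 < (v.comp w).length := by
      rw [Path.length_comp]
      omega
    have hl : ofPath k (u.comp v) ∉ I := fun hm => h.ne_zero (by
      rw [← Path.comp_assoc]; exact ofPath_mem_of_left hm)
    have hl' : ofPath k (u'.comp v) ∉ I := fun hm => h'.ne_zero (by
      rw [← Path.comp_assoc]; exact ofPath_mem_of_left hm)
    have hr : ofPath k (v.comp w) ∉ I := fun hm => h.ne_zero (ofPath_mem_of_right hm)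
    have hr' : ofPath k (v.comp w') ∉ I := fun hm => h'.ne_zero (ofPath_mem_of_right hm)
    -- A prolongation of `u v` or `v w` would glue with the rest along a nontrivial path to a
    -- prolongation of the maximal path.
    refine ⟨hI.exists_comp_eq_of_forall_comp_mem hv (fun c α => ?_) hl hl',
      hI.exists_comp_eq_of_forall_cons_mem hv (fun c β => ?_) hr hr'⟩
    · by_contra hm
      rw [← Path.comp_assoc] at hm
      have := hI.comp_comp_notMem hv hm hr
      rw [Path.comp_assoc] at this
      exact this (h.arrow_comp c α)
    · by_contra hm
      have := hI.comp_comp_notMem (r := β.toPath) hpos h.ne_zero hm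
      exact this (h.comp_arrow c β)
  -- By symmetry each outer part prolongs the other, so comparing lengths shows that the differences
  -- `z` and `t` are trivial.
  obtain ⟨⟨z, rfl⟩, ⟨t, rfl⟩⟩ := key h h'
  obtain ⟨⟨z', hz⟩, ⟨t', ht⟩⟩ := key h' h
  have hz0 : z.length = 0 := by
    have := congrArg Path.length hz
    simp only [Path.length_comp] at this
    omega
  have ht0 : t.length = 0 := by
    have := congrArg Path.length ht
    simp only [Path.length_comp] at this
    omega
  obtain rfl := Path.eq_of_length_zero z hz0
  obtain rfl := Path.eq_nil_of_length_zero z hz0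
  obtain rfl := Path.eq_of_length_zero t ht0
  obtain rfl := Path.eq_nil_of_length_zero t ht0
  simp

theorem finite_out (a : Q) : Finite (Σ b, a ⟶ b) :=
  ENat.card_lt_top.1 ((hI.specialBiserial.out_le a).trans_lt (by decide))

theorem finite_setOf_length_eq (n : ℕ) : {p : AllPaths Q | p.2.2.length = n}.Finite := by
  have := hI.finite_vertices
  induction n with
  | zero =>
    refine (Set.finite_range fun a : Q => (⟨a, a, .nil⟩ : AllPaths Q)).subset ?_
    rintro ⟨a, b, p⟩ hp
    obtain rfl := Path.eq_of_length_zero p hp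
    obtain rfl := Path.eq_nil_of_length_zero p hp
    exact ⟨a, rfl⟩
  | succ n ih =>
    have := hI.finite_out
    refine (ih.biUnion fun p _ => Set.finite_range fun β : Σ c, p.2.1 ⟶ c =>
      (⟨p.1, β.1, p.2.2.cons β.2⟩ : AllPaths Q)).subset ?_
    rintro ⟨a, b, p⟩ hp
    cases p with
    | nil => simp at hp
    | @cons c _ p β =>
      simp only [Set.mem_iUnion]
      exact ⟨⟨a, c, p⟩, by simpa using hp, ⟨b, β⟩, rfl⟩

/-- Lengths of nonzero paths are bounded, and at most two arrows start at each of the finitely many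
vertices. Finiteness is what makes the coefficient forms a basis of `DA`. -/
theorem finite_nonzeroPath : Finite {p : AllPaths Q // ofPath k p.2.2 ∉ I} := by
  obtain ⟨m, hm⟩ := hI.exists_length_lt
  refine Set.Finite.to_subtype (s := {p : AllPaths Q | ofPath k p.2.2 ∉ I})
    (((Set.finite_Iio m).biUnion fun n _ => hI.finite_setOf_length_eq n).subset ?_)
  intro p hp
  simp only [Set.mem_iUnion]
  exact ⟨_, hm _ _ _ hp, rfl⟩

end IsGentle

end

/-! ### The basis of a gentle algebra -/

section

open BoundQuiverAlgebra

variable (I : TwoSidedIdeal (PathAlgebra k Q))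

/-- The paths that are nonzero in `kQ/I`. -/
abbrev NonzeroPath := {p : AllPaths Q // ofPath k p.2.2 ∉ I}

open Classical in
/-- The linear form on `kQ/I` that takes the coefficient of a path `p ∉ I`. -/
def pathDual {a b : Q} (p : Path a b) : Module.Dual k (BoundQuiverAlgebra I) :=
  -- For gentle `I` and `p ∉ I` the coefficient vanishes on `I`, so the default value `0` does not
  -- occur.
  if h : ∀ x ∈ I, (Finsupp.lapply ⟨a, b, p⟩ ∘ₗ (coeff k Q).toLinearMap) x = 0 then
    liftₗ _ h else 0

variable {I}

namespace IsGentle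

variable (hI : IsGentle I)
include hI

theorem pathDual_mk {a b : Q} {p : Path a b} (hp : ofPath k p ∉ I) (x : PathAlgebra k Q) :
    pathDual I p (BoundQuiverAlgebra.mk I x) = coeff k Q x ⟨a, b, p⟩ := by
  have h : ∀ x ∈ I, (Finsupp.lapply ⟨a, b, p⟩ ∘ₗ (coeff k Q).toLinearMap) x = 0 :=
    fun x hx => hI.coeff_eq_zero hx p hp
  rw [pathDual, dif_pos h]
  rfl

theorem linearIndependent_nonzeroPath :
    LinearIndependent k fun p : NonzeroPath I => BoundQuiverAlgebra.mk I (ofPath k p.1.2.2) := by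
  classical
  rw [linearIndependent_iff']
  intro s g hg p hp
  have := congrArg (pathDual I p.1.2.2) hg
  rw [map_sum, map_zero, Finset.sum_eq_single p] at this
  · rw [map_smul, hI.pathDual_mk p.2, coeff_ofPath, if_pos rfl] at this
    simpa using this
  · intro q _ hqp
    rw [map_smul, hI.pathDual_mk p.2, coeff_ofPath, if_neg, smul_zero]
    exact fun h => hqp (Subtype.ext h.symm)
  · exact fun h => (h hp).elim

/-- The nonzero paths form a basis of `kQ/I`. -/
def basis : Module.Basis (NonzeroPath I) k (BoundQuiverAlgebra I) :=
  Module.Basis.mk hI.linearIndependent_nonzeroPath (by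
    rw [← span_range_ofPath, Submodule.span_le]
    rintro _ ⟨p, rfl⟩
    by_cases hp : ofPath k p.2.2 ∈ I
    · simp only [(mk_eq_zero I).2 hp, SetLike.mem_coe, zero_mem]
    · exact Submodule.subset_span ⟨⟨p, hp⟩, rfl⟩)

theorem basis_apply (p : NonzeroPath I) : hI.basis p = BoundQuiverAlgebra.mk I (ofPath k p.1.2.2) := by
  simp [basis]

open Classical in
/-- The basis of `D(kQ/I)` dual to the basis of nonzero paths. -/
def dualBasis : Module.Basis (NonzeroPath I) k (Module.Dual k (BoundQuiverAlgebra I)) :=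
  haveI := hI.finite_nonzeroPath
  hI.basis.dualBasis

theorem dualBasis_apply (p : NonzeroPath I) : hI.dualBasis p = pathDual I p.1.2.2 := by
  classical
  have := hI.finite_nonzeroPath
  refine hI.basis.ext fun q => ?_
  rw [dualBasis, Module.Basis.dualBasis_apply_self, hI.basis_apply, hI.pathDual_mk p.2,
    coeff_ofPath]
  exact if_congr ⟨fun h => by rw [h], fun h => Subtype.ext h.symm⟩ rfl rfl

/-- Together with its three companions, this describes `DA` on the dual basis: a path acting on the
right cancels itself from the end of a dual path, on the left from the start, and gives zero if it
does not occur there. -/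
theorem dualRight_pathDual {a b c : Q} {p : Path a b} {q : Path b c}
    (h : ofPath k (p.comp q) ∉ I) :
    BiSeq.dualRight (pathDual I (p.comp q)) (BoundQuiverAlgebra.mk I (ofPath k q)) = pathDual I p := by
  ext x
  obtain ⟨x, rfl⟩ := mk_surjective I x
  change pathDual I (p.comp q) (BoundQuiverAlgebra.mk I (ofPath k q * x)) = _
  rw [hI.pathDual_mk h, hI.pathDual_mk fun h' => h (ofPath_mem_of_left h'), coeff_ofPath_mul]

theorem dualRight_pathDual_eq_zero {a b c d : Q} {p : Path a b} {q : Path c d}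
    (hp : ofPath k p ∉ I)
    (h : ∀ (a' : Q) (r : Path a' c), (⟨a, b, p⟩ : AllPaths Q) ≠ ⟨a', d, r.comp q⟩) :
    BiSeq.dualRight (pathDual I p) (BoundQuiverAlgebra.mk I (ofPath k q)) = 0 := by
  ext x
  obtain ⟨x, rfl⟩ := mk_surjective I x
  change pathDual I p (BoundQuiverAlgebra.mk I (ofPath k q * x)) = _
  rw [hI.pathDual_mk hp, coeff_ofPath_mul_eq_zero _ _ _ h]
  rfl

theorem dualLeft_pathDual {a b c : Q} {p : Path a b} {q : Path b c}
    (h : ofPath k (p.comp q) ∉ I) :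
    BiSeq.dualLeft (BoundQuiverAlgebra.mk I (ofPath k p)) (pathDual I (p.comp q)) = pathDual I q := by
  ext x
  obtain ⟨x, rfl⟩ := mk_surjective I x
  change pathDual I (p.comp q) (BoundQuiverAlgebra.mk I (x * ofPath k p)) = _
  rw [hI.pathDual_mk h, hI.pathDual_mk fun h' => h (ofPath_mem_of_right h'), coeff_mul_ofPath]

theorem dualLeft_pathDual_eq_zero {a b c d : Q} {p : Path a b} {q : Path c d}
    (hp : ofPath k p ∉ I)
    (h : ∀ (b' : Q) (r : Path d b'), (⟨a, b, p⟩ : AllPaths Q) ≠ ⟨c, b', q.comp r⟩) :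
    BiSeq.dualLeft (BoundQuiverAlgebra.mk I (ofPath k q)) (pathDual I p) = 0 := by
  ext x
  obtain ⟨x, rfl⟩ := mk_surjective I x
  change pathDual I p (BoundQuiverAlgebra.mk I (x * ofPath k q)) = _
  rw [hI.pathDual_mk hp, coeff_mul_ofPath_eq_zero _ _ _ h]
  rfl

end IsGentle

end

end

/-! ### Half-edges, valencies and the cycles of the coverings -/

noncomputable section
open Quiver

universe u v w

open PathAlgebra

theorem Quiver.Path.exists_comp_eq_of_le_length {Q : Type u} [Quiver.{v} Q] {a b : Q}
    (m : Path a b) {n : ℕ} (hn : n ≤ m.length) :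
    ∃ (x : Q) (p : Path a x) (q : Path x b), p.comp q = m ∧ p.length = n := by
  induction m with
  | nil => exact ⟨a, .nil, .nil, rfl, (Nat.le_zero.1 hn).symm⟩
  | cons m α ih =>
    rcases Nat.lt_or_ge n (m.cons α).length with h | h
    · obtain ⟨x, p, q, rfl, hp⟩ := ih (Nat.le_of_lt_succ h)
      exact ⟨x, p, q.cons α, rfl, hp⟩
    · exact ⟨_, m.cons α, .nil, rfl, le_antisymm h hn⟩

theorem Quiver.Path.comp_eq_comp {Q : Type u} [Quiver.{v} Q] {a b x x' : Q}
    {p : Path a x} {q : Path x b} {p' : Path a x'} {q' : Path x' b}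
    (h : p.comp q = p'.comp q') (hl : p.length = p'.length) :
    (⟨x, p, q⟩ : Σ x, Path a x × Path x b) = ⟨x', p', q'⟩ := by
  have hq : q.length = q'.length := by
    have := congrArg Path.length h
    simp only [Path.length_comp] at this
    omega
  induction q with
  | nil =>
    obtain rfl := Path.eq_of_length_zero q' hq.symm
    obtain rfl := Path.eq_nil_of_length_zero q' hq.symm
    have h : p = p' := h
    rw [h]
  | cons q α ih =>
    cases q' with
    | nil => simp at hq
    | cons q' β =>
      rw [Path.comp_cons, Path.comp_cons] at h
      obtain rfl := Path.obj_eq_of_cons_eq_cons h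
      obtain rfl := eq_of_heq (Path.hom_heq_of_cons_eq_cons h)
      have := ih (eq_of_heq (Path.heq_of_cons_eq_cons h)) (by simpa using hq)
      cases this
      rfl

namespace RibbonData

variable {V : Type u} {H : Type v} (Γ : RibbonData V H) (D : Set H) {J : Type w}
  [AddGroupWithOne J]

/-- This lets statements about `Γ` be read off from its covering by `ℤ`. -/
theorem fst_cover_ρ_zpow (n : ℤ) (x : H × J) : (((Γ.cover D J).ρ ^ n) x).1 = (Γ.ρ ^ n) x.1 := by
  have h : ∀ y, ((Γ.cover D J).ρ y).1 = Γ.ρ y.1 := fun _ => rfl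
  have h' : ∀ y, ((Γ.cover D J).ρ⁻¹ y).1 = Γ.ρ⁻¹ y.1 := fun _ => rfl
  induction n with
  | zero => rfl
  | succ n ih => rw [add_comm, zpow_one_add, Equiv.Perm.mul_apply, h, ih, zpow_one_add,
      Equiv.Perm.mul_apply]
  | pred n ih => rw [sub_eq_add_neg, add_comm, zpow_add, zpow_neg_one, Equiv.Perm.mul_apply, h', ih,
      zpow_add, zpow_neg_one, Equiv.Perm.mul_apply]

end RibbonData

variable {k : Type w} [Field k] {Q : Type u} [Quiver.{v} Q] {I : TwoSidedIdeal (PathAlgebra k Q)}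

namespace GentleHalfEdge

theorem vertex_eq_path {h : GentleHalfEdge I} {a b : Q} {m : Path a b} {hm : IsMaximalPath I m}
    (e : h.vertex = .path m hm) : ∃ (x : Q) (p : Path a x) (q : Path x b) (e : p.comp q = m),
      h = pass p q (e ▸ hm) := by
  cases h with
  | pass p q hpq =>
    obtain ⟨rfl, rfl, e⟩ := GentleVertex.path.inj e
    exact ⟨_, p, q, eq_of_heq e, rfl⟩
  | added x hx => simp [vertex] at e

theorem vertex_eq_added {h : GentleHalfEdge I} {x : Q} {hx : IsAddedVertex I x}
    (e : h.vertex = .added x hx) : h = added x hx := by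
  cases h with
  | pass p q hpq => simp [vertex] at e
  | added y hy =>
    obtain rfl := GentleVertex.added.inj e
    rfl

theorem vertex_next (h : GentleHalfEdge I) : h.next.vertex = h.vertex := by
  have key : ∀ {a b : Q} {m m' : Path a b} (hm : IsMaximalPath I m) (hm' : IsMaximalPath I m'),
      m = m' → GentleVertex.path m hm = .path m' hm' := by
    rintro a b m _ hm hm' rfl
    rfl
  match h with
  | pass p .nil h => exact key _ _ (Path.nil_comp p)
  | pass p (.cons q β) h =>
    exact key _ _ (cons_comp_eq p (splitFirst (q.cons β) (Nat.succ_pos _)).2).symm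
  | added x hx => rfl

end GentleHalfEdge

open GentleHalfEdge

theorem gentleGraph_val_path {a b : Q} (m : Path a b) (hm : IsMaximalPath I m) :
    (gentleGraph I).val (.path m hm) = m.length + 1 := by
  -- A passage is numbered by the length of the part before it. The `min` and the value `0` only
  -- make the definition typecheck before `p.comp q = m` is known.
  let f : {h : GentleHalfEdge I // h.vertex = .path m hm} → Fin (m.length + 1) := fun h =>
    ⟨match h.1 with
      | .pass p _ _ => min p.length m.length
      | .added _ _ => 0, by
      split
      · exact Nat.lt_succ_of_le (min_le_right _ _)
      · exact Nat.succ_pos _⟩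
  have hf : Function.Bijective f := by
    constructor
    · rintro ⟨h, e⟩ ⟨h', e'⟩ hh
      obtain ⟨x, p, q, rfl, rfl⟩ := vertex_eq_path e
      obtain ⟨x', p', q', e'', rfl⟩ := vertex_eq_path e'
      have := congrArg Fin.val hh
      simp only [f] at this
      have h1 := congrArg Path.length e''
      simp only [Path.length_comp] at h1 this
      have := Path.comp_eq_comp e'' (by omega)
      cases this
      rfl
    · rintro ⟨n, hn⟩
      obtain ⟨x, p, q, rfl, rfl⟩ := m.exists_comp_eq_of_le_length (Nat.le_of_lt_succ hn)
      exact ⟨⟨pass p q hm, rfl⟩, Fin.ext (by simp [f])⟩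
  exact (Nat.card_eq_of_bijective f hf).trans (Nat.card_fin _)

theorem gentleGraph_val_added (x : Q) (hx : IsAddedVertex I x) :
    (gentleGraph I).val (.added x hx) = 1 := by
  rw [RibbonData.val, Nat.card_eq_one_iff_exists]
  exact ⟨⟨added x hx, rfl⟩, fun h => Subtype.ext (vertex_eq_added h.2)⟩

theorem gentleGraph_val_pos (v : GentleVertex I) : 0 < (gentleGraph I).val v := by
  cases v with
  | path m hm => simp [gentleGraph_val_path]
  | added x hx => simp [gentleGraph_val_added]

/-! ### The successor of a half-edge in the covering -/

section cover

variable (I) in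
/-- The covering of the ribbon graph of `kQ/I`. -/
abbrev gentleCover (J : Type*) [AddGroupWithOne J] : RibbonData (GentleVertex I)
    (GentleHalfEdge I × J) :=
  (gentleGraph I).cover (gentleCut I) J

variable {J : Type*} [AddGroupWithOne J]

theorem cover_ρ_of_not_isLast {h : GentleHalfEdge I} (hh : ¬ h.IsLast) (j : J) :
    (gentleCover I J).ρ (h, j) = (h.next, j) :=
  Prod.ext rfl (if_neg hh)

theorem cover_ρ_of_isLast {h : GentleHalfEdge I} (hh : h.IsLast) (j : J) :
    (gentleCover I J).ρ (h, j) = (h.next, j + 1) :=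
  Prod.ext rfl (if_pos hh)

theorem not_isLast_pass {a x y b : Q} (p : Path a x) (β : x ⟶ y) (q : Path y b)
    (h : IsMaximalPath I (p.comp (β.toPath.comp q))) :
    ¬ (pass p (β.toPath.comp q) h).IsLast := by
  change (β.toPath.comp q).length ≠ 0
  rw [Path.length_comp, Path.length_toPath]
  omega

theorem cover_ρ_pass {a x y b : Q} (p : Path a x) (β : x ⟶ y) (q : Path y b)
    (h : IsMaximalPath I (p.comp (β.toPath.comp q))) (h' : IsMaximalPath I ((p.cons β).comp q))
    (j : J) : (gentleCover I J).ρ (pass p (β.toPath.comp q) h, j) = (pass (p.cons β) q h', j) := by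
  rw [cover_ρ_of_not_isLast (not_isLast_pass p β q h), next_pass]

theorem cover_ρ_pass_nil {a b : Q} (p : Path a b) (h : IsMaximalPath I (p.comp .nil))
    (h' : IsMaximalPath I (Path.nil.comp p)) (j : J) :
    (gentleCover I J).ρ (pass p .nil h, j) = (pass .nil p h', j + 1) :=
  cover_ρ_of_isLast (h := pass p .nil h) (show (Path.nil : Path b b).length = 0 from rfl) j

theorem cover_ρ_added (x : Q) (hx : IsAddedVertex I x) (j : J) :
    (gentleCover I J).ρ (added x hx, j) = (added x hx, j + 1) :=
  cover_ρ_of_isLast (h := added x hx) trivial j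

omit [AddGroupWithOne J] in
theorem pass_congr' {a x b : Q} {p p' : Path a x} {q q' : Path x b} (hp : p = p') (hq : q = q')
    (h : IsMaximalPath I (p.comp q)) (h' : IsMaximalPath I (p'.comp q')) (j : J) :
    (pass p q h, j) = (pass p' q' h', j) := by
  rw [pass_congr hp hq h h']

theorem cover_ρ_pow_length {a x y b : Q} (p : Path a x) (q : Path x y) (r : Path y b)
    (h : IsMaximalPath I (p.comp (q.comp r))) (h' : IsMaximalPath I ((p.comp q).comp r)) (j : J) :
    ((gentleCover I J).ρ ^ q.length) (pass p (q.comp r) h, j) = (pass (p.comp q) r h', j) := by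
  induction q with
  | nil => exact pass_congr' rfl (Path.nil_comp r) _ _ _
  | cons q β ih =>
    have e : (q.cons β).comp r = q.comp (β.toPath.comp r) := by
      rw [← Path.comp_toPath_eq_cons, Path.comp_assoc]
    have h1 : IsMaximalPath I (p.comp (q.comp (β.toPath.comp r))) := e ▸ h
    have h2 : IsMaximalPath I ((p.comp q).comp (β.toPath.comp r)) := by
      rwa [Path.comp_assoc]
    rw [Path.length_cons, pow_succ', Equiv.Perm.mul_apply, pass_congr' rfl e h h1, ih _ h1 h2,
      cover_ρ_pass (p.comp q) β r h2 h']
    rfl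

/-- Go along `r` to the end, take one step through the cut into the next sheet, then go along `p`;
this accounts for `r.length + 1 + p.length`. -/
theorem cover_ρ_pow_wrap {a x y b : Q} (p : Path a x) (q : Path x y) (r : Path y b)
    (h : IsMaximalPath I ((p.comp q).comp r)) (h' : IsMaximalPath I (p.comp (q.comp r))) (j : J) :
    ((gentleCover I J).ρ ^ (r.length + 1 + p.length)) (pass (p.comp q) r h, j) =
      (pass p (q.comp r) h', j + 1) := by
  have h0 : IsMaximalPath I ((p.comp q).comp (r.comp .nil)) := h
  have h1 : IsMaximalPath I (((p.comp q).comp r).comp .nil) := h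
  have h2 : IsMaximalPath I (Path.nil.comp ((p.comp q).comp r)) := by rwa [Path.nil_comp]
  have h3 : IsMaximalPath I (Path.nil.comp (p.comp (q.comp r))) := by rwa [Path.nil_comp]
  have h4 : IsMaximalPath I ((Path.nil.comp p).comp (q.comp r)) := by rwa [Path.nil_comp]
  rw [add_comm, pow_add, Equiv.Perm.mul_apply, add_comm, pow_add, Equiv.Perm.mul_apply, pow_one,
    pass_congr' rfl (Path.comp_nil r).symm h h0, cover_ρ_pow_length _ r .nil h0 h1,
    cover_ρ_pass_nil _ h1 h2, pass_congr' rfl (Path.comp_assoc p q r) h2 h3,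
    cover_ρ_pow_length _ p (q.comp r) h3 h4, pass_congr' (Path.nil_comp p) rfl h4 h']

/-- A full turn crosses the cut exactly once. -/
theorem cover_ρ_pow_val (h : GentleHalfEdge I) (j : J) :
    ((gentleCover I J).ρ ^ (gentleGraph I).val h.vertex) (h, j) = (h, j + 1) := by
  cases h with
  | pass p q h =>
    have e : (gentleGraph I).val (pass p q h).vertex = q.length + 1 + p.length := by
      rw [vertex, gentleGraph_val_path, Path.length_comp]
      omega
    have h1 : IsMaximalPath I ((p.comp .nil).comp q) := h
    have h2 : IsMaximalPath I (p.comp (Path.nil.comp q)) := by rwa [Path.nil_comp]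
    rw [e]
    refine (cover_ρ_pow_wrap p .nil q h1 h2 j).trans (pass_congr' rfl (Path.nil_comp q) _ _ _)
  | added x hx =>
    rw [vertex, gentleGraph_val_added, pow_one, cover_ρ_added]

theorem cover_ρ_zpow_val (h : GentleHalfEdge I) (j : J) (n : ℤ) :
    ((gentleCover I J).ρ ^ (n * ((gentleGraph I).val h.vertex : ℤ))) (h, j) = (h, j + n) := by
  have key : ∀ (j : J) (n : ℕ),
      ((gentleCover I J).ρ ^ ((n : ℤ) * ((gentleGraph I).val h.vertex : ℤ))) (h, j) =
        (h, j + n) := by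
    intro j n
    induction n with
    | zero => simp
    | succ n ih =>
      rw [Nat.cast_succ, add_mul, add_comm, zpow_add, Equiv.Perm.mul_apply, ih, one_mul,
        zpow_natCast, cover_ρ_pow_val, Nat.cast_succ, add_assoc]
  obtain ⟨n, rfl | rfl⟩ := n.eq_nat_or_neg
  · simpa using key j n
  · rw [neg_mul, zpow_neg, Equiv.Perm.inv_eq_iff_eq, key]
    simp

/-- Within a sheet every passage is reached from the first one of its path, and `n` full turns
change the sheet by `n`. Surjectivity of `ℤ → J` puts all sheets over a vertex in one cycle, so the
covering needs no new vertices. -/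
theorem cover_sameCycle_iff (hJ : Function.Surjective (Int.cast : ℤ → J))
    (x y : GentleHalfEdge I × J) :
    (gentleCover I J).ρ.SameCycle x y ↔ x.1.vertex = y.1.vertex := by
  constructor
  · have h1 : ∀ x, ((gentleCover I J).ρ x).1.vertex = x.1.vertex := fun x => vertex_next x.1
    have h2 : ∀ x, ((gentleCover I J).ρ⁻¹ x).1.vertex = x.1.vertex := fun x =>
      (h1 _).symm.trans (congrArg (·.1.vertex) (Equiv.apply_symm_apply _ x))
    rintro ⟨n, rfl⟩
    induction n with
    | zero => rfl
    | succ n ih => rw [add_comm, zpow_one_add, Equiv.Perm.mul_apply, h1, ih]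
    | pred n ih =>
      rw [ih, sub_eq_add_neg, add_comm, zpow_add, zpow_neg_one, Equiv.Perm.mul_apply, h2]
  · obtain ⟨h, i⟩ := x
    obtain ⟨h', j⟩ := y
    intro e
    have key : ∀ (h : GentleHalfEdge I) (i j : J), (gentleCover I J).ρ.SameCycle (h, i) (h, j) := by
      intro h i j
      obtain ⟨n, hn⟩ := hJ (-i + j)
      exact ⟨_, (cover_ρ_zpow_val h i n).trans (by simp [hn])⟩
    have key2 : ∀ {a x b : Q} (p : Path a x) (q : Path x b) (m : Path a b)
        (h : IsMaximalPath I (p.comp q)) (h' : IsMaximalPath I (Path.nil.comp m)), p.comp q = m →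
        (gentleCover I J).ρ.SameCycle (pass .nil m h', j) (pass p q h, j) := by
      rintro a x b p q _ h h' rfl
      have h1 : IsMaximalPath I ((Path.nil.comp p).comp q) := by rwa [Path.nil_comp]
      refine ⟨p.length, ?_⟩
      rw [zpow_natCast, cover_ρ_pow_length .nil p q h' h1]
      exact pass_congr' (Path.nil_comp p) rfl _ _ _
    refine (key h i j).trans ?_
    change h.vertex = h'.vertex at e
    cases h' with
    | pass p' q' hpq' =>
      obtain ⟨x, p, q, e', rfl⟩ := vertex_eq_path e
      have h1 : IsMaximalPath I (Path.nil.comp (p'.comp q')) := by rwa [Path.nil_comp]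
      exact (key2 p q _ _ h1 e').symm.trans (key2 p' q' _ hpq' h1 rfl)
    | added x hx =>
      obtain rfl := vertex_eq_added e
      exact .refl _ _

end cover

theorem gentleGraph_sameCycle_iff (h h' : GentleHalfEdge I) :
    (gentleGraph I).ρ.SameCycle h h' ↔ h.vertex = h'.vertex := by
  constructor
  · rintro ⟨n, rfl⟩
    rw [← RibbonData.fst_cover_ρ_zpow _ (gentleCut I) n ((h, 0) : _ × ℤ)]
    exact (cover_sameCycle_iff (fun n => ⟨n, Int.cast_id⟩) (h, 0) _).1 ⟨n, rfl⟩
  · intro e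
    obtain ⟨n, hn⟩ := (cover_sameCycle_iff (J := ℤ) (fun n => ⟨n, Int.cast_id⟩) (h, 0) (h', 0)).2 e
    refine ⟨n, ?_⟩
    have := RibbonData.fst_cover_ρ_zpow (gentleGraph I) (gentleCut I) n ((h, 0) : _ × ℤ)
    rw [hn] at this
    exact this.symm

theorem gentleGraph_ρ_zpow_val (h : GentleHalfEdge I) (n : ℤ) :
    ((gentleGraph I).ρ ^ (n * ((gentleGraph I).val h.vertex : ℤ))) h = h := by
  rw [← RibbonData.fst_cover_ρ_zpow _ (gentleCut I) _ ((h, 0) : _ × ℤ), cover_ρ_zpow_val]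

theorem gentleGraph_ρ_pow_val (h : GentleHalfEdge I) :
    ((gentleGraph I).ρ ^ (gentleGraph I).val h.vertex) h = h := by
  simpa using gentleGraph_ρ_zpow_val h 1

theorem isCuttingSet_gentleCut : (gentleGraph I).IsCuttingSet (gentleCut I) := by
  intro v
  cases v with
  | @path a b m hm =>
    refine ⟨pass m .nil hm, ⟨rfl, rfl⟩, ?_⟩
    rintro h ⟨e, hh⟩
    obtain ⟨x, p, q, rfl, rfl⟩ := vertex_eq_path e
    have hh : q.length = 0 := hh
    obtain rfl := Path.eq_of_length_zero q hh
    obtain rfl := Path.eq_nil_of_length_zero q hh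
    rfl
  | added x hx => exact ⟨added x hx, ⟨rfl, trivial⟩, fun h ⟨e, _⟩ => vertex_eq_added e⟩

/-! ### The half-edges at a vertex of the quiver -/

namespace IsGentle

variable (hI : IsGentle I)
include hI

theorem finite_gentleVertex : Finite (GentleVertex I) := by
  have := hI.finite_vertices
  have := hI.finite_nonzeroPath
  let f : GentleVertex I → NonzeroPath I ⊕ Q
    | .path m hm => .inl ⟨⟨_, _, m⟩, hm.ne_zero⟩
    | .added x _ => .inr x
  refine Finite.of_injective f ?_
  rintro (⟨m, hm⟩ | ⟨x, hx⟩) (⟨m', hm'⟩ | ⟨y, hy⟩) h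
  · have := congrArg Subtype.val (Sum.inl_injective h)
    cases this
    rfl
  · cases h
  · cases h
  · cases h
    rfl

theorem exists_pass {x y : Q} (q : Path x y) (hq : ofPath k q ∉ I) :
    ∃ (a b : Q) (p : Path a x) (r : Path y b), IsMaximalPath I (p.comp (q.comp r)) ∧
      IsMaximalPath I ((p.comp q).comp r) := by
  obtain ⟨a, b, p, r, h⟩ := hI.exists_isMaximalPath q hq
  exact ⟨a, b, p, r, h, by rwa [Path.comp_assoc]⟩

/-- Uniqueness of the maximal path around `q`, restated for half-edges: here the passage at the
start of `q`, in `pass_right_unique` the one at its end. -/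
theorem pass_left_unique {x y a a' b b' : Q} {q : Path x y} (hq : 0 < q.length)
    {p : Path a x} {p' : Path a' x} {r : Path y b} {r' : Path y b'}
    (h : IsMaximalPath I (p.comp (q.comp r))) (h' : IsMaximalPath I (p'.comp (q.comp r'))) :
    pass p (q.comp r) h = pass p' (q.comp r') h' := by
  obtain ⟨h1, h2⟩ := hI.isMaximalPath_unique hq h h'
  cases h1
  cases h2
  rfl

theorem pass_right_unique {x y a a' b b' : Q} {q : Path x y} (hq : 0 < q.length)
    {p : Path a x} {p' : Path a' x} {r : Path y b} {r' : Path y b'}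
    (h : IsMaximalPath I ((p.comp q).comp r)) (h' : IsMaximalPath I ((p'.comp q).comp r')) :
    pass (p.comp q) r h = pass (p'.comp q) r' h' := by
  have h1 := h
  have h1' := h'
  rw [Path.comp_assoc] at h1 h1'
  obtain ⟨h1, h2⟩ := hI.isMaximalPath_unique hq h1 h1'
  cases h1
  cases h2
  rfl

/-- The half-edges that leave an arrow `α` or enter an arrow `β`. -/
theorem exists_halfEdge_of_arrow (x : Q) : ∃ (σ : (Σ a, a ⟶ x) → GentleHalfEdge I)
    (τ : (Σ c, x ⟶ c) → GentleHalfEdge I),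
    (∀ α, ∃ (a b : Q) (p : Path a α.1) (q : Path x b) (h : IsMaximalPath I ((p.cons α.2).comp q)),
      σ α = pass (p.cons α.2) q h) ∧
    (∀ β, ∃ (a b : Q) (p : Path a x) (q : Path β.1 b)
      (h : IsMaximalPath I (p.comp (β.2.toPath.comp q))), τ β = pass p (β.2.toPath.comp q) h) := by
  have h1 : ∀ α : Σ a, a ⟶ x, ∃ (h : GentleHalfEdge I) (a b : Q) (p : Path a α.1) (q : Path x b)
      (h' : IsMaximalPath I ((p.cons α.2).comp q)), h = pass (p.cons α.2) q h' := by
    rintro ⟨y, α⟩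
    obtain ⟨a, b, p, q, -, h⟩ := hI.exists_pass α.toPath (hI.toPath_notMem α)
    exact ⟨_, a, b, p, q, h, rfl⟩
  have h2 : ∀ β : Σ c, x ⟶ c, ∃ (h : GentleHalfEdge I) (a b : Q) (p : Path a x) (q : Path β.1 b)
      (h' : IsMaximalPath I (p.comp (β.2.toPath.comp q))),
        h = pass p (β.2.toPath.comp q) h' := by
    rintro ⟨y, β⟩
    obtain ⟨a, b, p, q, h, -⟩ := hI.exists_pass β.toPath (hI.toPath_notMem β)
    exact ⟨_, a, b, p, q, h, rfl⟩
  choose σ hσ using h1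
  choose τ hτ using h2
  exact ⟨σ, τ, hσ, hτ⟩

omit hI in
theorem ofPath_notMem_of_pass_eq {a x b y a' z b' : Q} {α : y ⟶ x} {β : x ⟶ z} {p : Path a y}
    {q : Path x b} {p' : Path a' x} {q' : Path z b'} {h : IsMaximalPath I ((p.cons α).comp q)}
    {h' : IsMaximalPath I (p'.comp (β.toPath.comp q'))}
    (e : pass (p.cons α) q h = pass p' (β.toPath.comp q') h') :
    ofPath k (α.toPath.cons β) ∉ I := by
  intro hm
  obtain ⟨rfl, -, rfl, -, e⟩ := GentleHalfEdge.pass.inj e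
  obtain rfl := eq_of_heq e
  refine h.ne_zero ?_
  rw [← Path.comp_toPath_eq_cons, Path.comp_assoc, ← Path.comp_assoc α.toPath,
    Path.comp_toPath_eq_cons]
  exact ofPath_mem_of_right (ofPath_mem_of_left hm)

/-- Exactly two half-edges belong to each vertex of the quiver. -/
theorem exists_two_halfEdges (x : Q) : ∃ h₁ h₂ : GentleHalfEdge I, h₁ ≠ h₂ ∧ h₁.point = x ∧
    h₂.point = x ∧ ∀ h : GentleHalfEdge I, h.point = x → h = h₁ ∨ h = h₂ := by
  obtain ⟨σ, τ, hσ, hτ⟩ := hI.exists_halfEdge_of_arrow x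
  have hσx : ∀ α, (σ α).point = x := fun α => by
    obtain ⟨a, b, p, q, h, e⟩ := hσ α
    rw [e, point]
  have hτx : ∀ β, (τ β).point = x := fun β => by
    obtain ⟨a, b, p, q, h, e⟩ := hτ β
    rw [e, point]
  have hσi : Function.Injective σ := fun α α' hh => by
    obtain ⟨a, b, p, q, h, e⟩ := hσ α
    obtain ⟨a', b', p', q', h', e'⟩ := hσ α'
    rw [e, e'] at hh
    obtain ⟨rfl, -, -, hh, -⟩ := GentleHalfEdge.pass.inj hh
    have hh := eq_of_heq hh
    exact Sigma.ext (Path.obj_eq_of_cons_eq_cons hh) (Path.hom_heq_of_cons_eq_cons hh)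
  have hτi : Function.Injective τ := fun β β' hh => by
    obtain ⟨a, b, p, q, h, e⟩ := hτ β
    obtain ⟨a', b', p', q', h', e'⟩ := hτ β'
    rw [e, e'] at hh
    obtain ⟨-, -, rfl, -, hh⟩ := GentleHalfEdge.pass.inj hh
    have hh := Path.comp_eq_comp (eq_of_heq hh) rfl
    obtain ⟨y, β⟩ := β
    obtain ⟨y', β'⟩ := β'
    obtain ⟨rfl, hh⟩ := Sigma.mk.inj hh
    have hh := (Prod.mk.inj (eq_of_heq hh)).1
    exact congrArg _ (eq_of_heq (Path.hom_heq_of_cons_eq_cons hh))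
  -- With `hστ'`: the half-edge after `α` is the half-edge before `β` exactly when `α` followed by
  -- `β` is nonzero, since then both lie consecutively on one maximal path.
  have hστ : ∀ α β, ofPath k (α.2.toPath.cons β.2) ∉ I → σ α = τ β := fun α β hαβ => by
    obtain ⟨a, b, p, q, h, e⟩ := hσ α
    obtain ⟨a', b', p', q', h', e'⟩ := hτ β
    obtain ⟨a'', b'', p'', q'', h'', -⟩ := hI.exists_pass _ hαβ
    have h1 : IsMaximalPath I ((p''.cons α.2).comp (β.2.toPath.comp q'')) := by
      rwa [← Path.comp_toPath_eq_cons, Path.comp_assoc, ← Path.comp_assoc α.2.toPath,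
        Path.comp_toPath_eq_cons]
    rw [e, e']
    exact (hI.pass_right_unique (q := α.2.toPath) Nat.one_pos h h1).trans
      (hI.pass_left_unique (q := β.2.toPath) Nat.one_pos h1 h')
  have hστ' : ∀ α β, σ α = τ β → ofPath k (α.2.toPath.cons β.2) ∉ I := fun α β hαβ => by
    obtain ⟨a, b, p, q, h, e⟩ := hσ α
    obtain ⟨a', b', p', q', h', e'⟩ := hτ β
    rw [e, e'] at hαβ
    exact ofPath_notMem_of_pass_eq hαβ
  have hσa : ∀ α y hy, σ α ≠ added y hy := fun α y hy hh => by
    obtain ⟨a, b, p, q, h, e⟩ := hσ α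
    rw [e] at hh
    cases hh
  have hτa : ∀ β y hy, τ β ≠ added y hy := fun β y hy hh => by
    obtain ⟨a, b, p, q, h, e⟩ := hτ β
    rw [e] at hh
    cases hh
  -- A passage through `x` is determined by the arrow before it or by the arrow after it; with
  -- neither, the maximal path is trivial and `x` is isolated.
  have hall : ∀ h : GentleHalfEdge I, h.point = x → (∃ α, h = σ α) ∨ (∃ β, h = τ β) ∨
      ((∃ hx, h = pass (.nil : Path x x) .nil hx) ∧ IsEmpty (Σ a, a ⟶ x) ∧
        IsEmpty (Σ c, x ⟶ c)) ∨ ∃ hx, h = added x hx := by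
    rintro h rfl
    cases h with
    | @pass a y b p q h =>
      cases p with
      | @cons z _ p α =>
        obtain ⟨a', b', p', q', h', e'⟩ := hσ ⟨z, α⟩
        refine .inl ⟨⟨z, α⟩, ?_⟩
        rw [e']
        exact hI.pass_right_unique (q := α.toPath) Nat.one_pos h h'
      | nil =>
        by_cases hq : q.length = 0
        · obtain rfl := Path.eq_of_length_zero q hq
          obtain rfl := Path.eq_nil_of_length_zero q hq
          refine .inr (.inr (.inl ⟨⟨h, rfl⟩, ⟨fun α => ?_⟩, ⟨fun β => ?_⟩⟩))
          · exact hI.toPath_notMem α.2 (h.arrow_comp _ α.2)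
          · exact hI.toPath_notMem β.2 (h.comp_arrow _ β.2)
        · obtain ⟨z, β, q, rfl, -⟩ := (Path.length_ne_zero_iff_eq_comp q).1 hq
          obtain ⟨a', b', p', q', h', e'⟩ := hτ ⟨z, β⟩
          refine .inr (.inl ⟨⟨z, β⟩, ?_⟩)
          rw [e']
          exact hI.pass_left_unique (q := β.toPath) Nat.one_pos h h'
    | added y hy => exact .inr (.inr (.inr ⟨hy, rfl⟩))
  have card : ∀ X : Type (max u v), ENat.card X ≤ 2 → ENat.card X = 0 ∨ ENat.card X = 1 ∨
      ENat.card X = 2 := fun X hX => by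
    generalize ENat.card X = n at *
    cases n with
    | top => simp at hX
    | coe n =>
      norm_cast at *
      omega
  have card_two : ∀ X : Type (max u v), ENat.card X = 2 → ∃ y z : X, y ≠ z ∧ ∀ t, t = y ∨ t = z := by
    intro X hX
    have : Nat.card X = 2 := (ENat.toNat_eq_iff two_ne_zero).2 hX
    obtain ⟨y, z, hne, h⟩ := Nat.card_eq_two_iff.1 this
    exact ⟨y, z, hne, fun t => by simpa using (h.symm.subset (Set.mem_univ t) : t ∈ ({y, z} : Set X))⟩
  have card_one : ∀ X : Type (max u v), ENat.card X = 1 → ∃ y : X, ∀ t, t = y := by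
    intro X hX
    obtain ⟨_⟩ := ENat.card_eq_one_iff_unique.1 hX
    exact ⟨default, Unique.uniq _⟩
  -- With two incoming arrows the half-edges are their `σ`'s: an outgoing arrow has a relation with
  -- at most one of them, so its `τ` is one of these. Two outgoing arrows are treated likewise. With
  -- at most one arrow on each side, a second half-edge comes from a relation between the two arrows
  -- or from the added vertex.
  rcases card _ (hI.specialBiserial.in_le x) with hin | hin | hin
  · have hin' := (ENat.card_eq_zero_iff_empty _).1 hin
    rcases card _ (hI.specialBiserial.out_le x) with hout | hout | hout
    · have hout' := (ENat.card_eq_zero_iff_empty _).1 hout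
      have hm : IsMaximalPath I ((Path.nil : Path x x).comp .nil) :=
        ⟨hI.nil_notMem x, fun c α => (hout'.false ⟨c, α⟩).elim,
          fun c α => (hin'.false ⟨c, α⟩).elim⟩
      refine ⟨pass .nil .nil hm, added x (.inr (.inr (.inr ⟨hin, hout⟩))), by simp, rfl, rfl, ?_⟩
      intro h hh
      rcases hall h hh with ⟨α, -⟩ | ⟨β, -⟩ | ⟨⟨_, rfl⟩, -⟩ | ⟨_, rfl⟩
      · exact hin'.elim α
      · exact hout'.elim β
      · exact .inl rfl
      · exact .inr rfl
    · obtain ⟨β, hβ⟩ := card_one _ hout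
      refine ⟨τ β, added x (.inl ⟨hin, hout⟩), hτa _ _ _, hτx _, rfl, ?_⟩
      intro h hh
      rcases hall h hh with ⟨α, -⟩ | ⟨β', rfl⟩ | ⟨-, -, h'⟩ | ⟨_, rfl⟩
      · exact hin'.elim α
      · exact .inl (by rw [hβ β'])
      · exact (h'.false β).elim
      · exact .inr rfl
    · obtain ⟨β, β', hne, hβ⟩ := card_two _ hout
      refine ⟨τ β, τ β', hτi.ne hne, hτx _, hτx _, ?_⟩
      intro h hh
      rcases hall h hh with ⟨α, -⟩ | ⟨β'', rfl⟩ | ⟨-, -, h'⟩ | ⟨hx, rfl⟩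
      · exact hin'.elim α
      · rcases hβ β'' with rfl | rfl
        · exact .inl rfl
        · exact .inr rfl
      · exact (h'.false β).elim
      · simp [IsAddedVertex, hin, hout] at hx
  · obtain ⟨α, hα⟩ := card_one _ hin
    rcases card _ (hI.specialBiserial.out_le x) with hout | hout | hout
    · have hout' := (ENat.card_eq_zero_iff_empty _).1 hout
      refine ⟨σ α, added x (.inr (.inl ⟨hin, hout⟩)), hσa _ _ _, hσx _, rfl, ?_⟩
      intro h hh
      rcases hall h hh with ⟨α', rfl⟩ | ⟨β, -⟩ | ⟨-, h', -⟩ | ⟨_, rfl⟩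
      · exact .inl (congrArg σ (hα α'))
      · exact hout'.elim β
      · exact (h'.false α).elim
      · exact .inr rfl
    · obtain ⟨β, hβ⟩ := card_one _ hout
      by_cases hαβ : ofPath k (α.2.toPath.cons β.2) ∈ I
      · refine ⟨σ α, τ β, fun e => hστ' _ _ e hαβ, hσx _, hτx _, ?_⟩
        intro h hh
        rcases hall h hh with ⟨α', rfl⟩ | ⟨β', rfl⟩ | ⟨-, h', -⟩ | ⟨hx, rfl⟩
        · exact .inl (congrArg σ (hα α'))
        · exact .inr (by rw [hβ β'])
        · exact (h'.false α).elim
        · simp only [IsAddedVertex, hin, hout, one_ne_zero, false_and, and_false,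
            true_and, false_or, or_false] at hx
          exact (hx _ _ α.2 β.2 hαβ).elim
      · refine ⟨σ α, added x (.inr (.inr (.inl ⟨hin, hout, fun a c α' β' => ?_⟩))), hσa _ _ _,
          hσx _, rfl, ?_⟩
        · cases hα ⟨a, α'⟩
          cases hβ ⟨c, β'⟩
          exact hαβ
        · intro h hh
          rcases hall h hh with ⟨α', rfl⟩ | ⟨β', rfl⟩ | ⟨-, h', -⟩ | ⟨hx, rfl⟩
          · exact .inl (congrArg σ (hα α'))
          · exact .inl ((congrArg τ (hβ β')).trans (hστ _ _ hαβ).symm)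
          · exact (h'.false α).elim
          · exact .inr rfl
    · obtain ⟨β, β', hne, hβ⟩ := card_two _ hout
      refine ⟨τ β, τ β', hτi.ne hne, hτx _, hτx _, ?_⟩
      intro h hh
      rcases hall h hh with ⟨α', rfl⟩ | ⟨β'', rfl⟩ | ⟨-, -, h'⟩ | ⟨hx, rfl⟩
      · by_cases h1 : ofPath k (α'.2.toPath.cons β.2) ∈ I
        · by_cases h2 : ofPath k (α'.2.toPath.cons β'.2) ∈ I
          · exact (hne (hI.out_relation_unique α'.2 h1 h2)).elim
          · exact .inr (hστ _ _ h2)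
        · exact .inl (hστ _ _ h1)
      · rcases hβ β'' with rfl | rfl
        · exact .inl rfl
        · exact .inr rfl
      · exact (h'.false β).elim
      · simp [IsAddedVertex, hin, hout] at hx
  · obtain ⟨α, α', hne, hα⟩ := card_two _ hin
    refine ⟨σ α, σ α', hσi.ne hne, hσx _, hσx _, ?_⟩
    intro h hh
    rcases hall h hh with ⟨α'', rfl⟩ | ⟨β, rfl⟩ | ⟨-, h', -⟩ | ⟨hx, rfl⟩
    · rcases hα α'' with rfl | rfl
      · exact .inl rfl
      · exact .inr rfl
    · by_cases h1 : ofPath k (α.2.toPath.cons β.2) ∈ I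
      · by_cases h2 : ofPath k (α'.2.toPath.cons β.2) ∈ I
        · exact (hne (hI.in_relation_unique β.2 h1 h2)).elim
        · exact .inr (hστ _ _ h2).symm
      · exact .inl (hστ _ _ h1).symm
    · exact (h'.false α).elim
    · simp [IsAddedVertex, hin] at hx

theorem opposite_spec (h : GentleHalfEdge I) : h.opposite ≠ h ∧ h.opposite.point = h.point := by
  have H : ∃ h', h' ≠ h ∧ h'.point = h.point := by
    obtain ⟨h₁, h₂, hne, e₁, e₂, hall⟩ := hI.exists_two_halfEdges h.point
    by_cases e : h₁ = h
    · exact ⟨h₂, by rw [← e]; exact hne.symm, e₂⟩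
    · exact ⟨h₁, e, e₁⟩
  rw [GentleHalfEdge.opposite, dif_pos H]
  exact H.choose_spec

theorem eq_or_eq_opposite {h h' : GentleHalfEdge I} (e : h'.point = h.point) :
    h' = h ∨ h' = h.opposite := by
  obtain ⟨h1, h2⟩ := hI.opposite_spec h
  obtain ⟨h₁, h₂, -, -, -, hall⟩ := hI.exists_two_halfEdges h.point
  rcases hall h rfl with e1 | e1 <;> rcases hall h' e with e2 | e2 <;>
    rcases hall _ h2 with e3 | e3 <;> simp_all

theorem opposite_opposite (h : GentleHalfEdge I) : h.opposite.opposite = h := by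
  obtain ⟨h1, h2⟩ := hI.opposite_spec h
  obtain ⟨h3, h4⟩ := hI.opposite_spec h.opposite
  rcases hI.eq_or_eq_opposite (h := h) (h4.trans h2) with e | e
  · exact e
  · exact (h3 e).elim

theorem isRibbonGraph : (gentleGraph I).IsRibbonGraph where
  finite_vertices := hI.finite_gentleVertex
  involutive := hI.opposite_opposite
  ι_ne h := (hI.opposite_spec h).1
  surjective := by
    rintro (⟨m, hm⟩ | ⟨x, hx⟩)
    · exact ⟨pass m .nil hm, rfl⟩
    · exact ⟨added x hx, rfl⟩
  sameCycle_iff := gentleGraph_sameCycle_iff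

theorem isBrauerGraph : (gentleGraph I).IsBrauerGraph (gentleGraph I).val where
  isAFBG :=
    { isRibbonGraph := hI.isRibbonGraph
      degree_pos := gentleGraph_val_pos
      ι_nakayama := fun h =>
        (congrArg _ (gentleGraph_ρ_pow_val h)).trans (gentleGraph_ρ_pow_val _).symm
      admissible := fun h n => by
        refine ((gentleGraph_ρ_zpow_val h n).trans_ne ?_)
        exact (hI.opposite_spec h).1.symm }
  val_pos := gentleGraph_val_pos
  val_dvd _ := dvd_rfl

/-- The Nakayama automorphism is the shift of sheets by one. It commutes with `ι`, and its powers
never give `ι` since they fix the underlying half-edge. -/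
theorem isAFBG_cover {J : Type*} [AddGroupWithOne J] (hJ : Function.Surjective (Int.cast : ℤ → J)) :
    (gentleCover I J).IsAFBG (gentleGraph I).val where
  isRibbonGraph :=
    { finite_vertices := hI.finite_gentleVertex
      involutive := fun x => Prod.ext (hI.opposite_opposite x.1) rfl
      ι_ne := fun x e => (hI.opposite_spec x.1).1 (congrArg Prod.fst e)
      surjective := fun v => by
        obtain ⟨h, rfl⟩ := hI.isRibbonGraph.surjective v
        exact ⟨(h, 0), rfl⟩
      sameCycle_iff := cover_sameCycle_iff hJ }
  degree_pos := gentleGraph_val_pos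
  ι_nakayama := fun x =>
    (congrArg _ (cover_ρ_pow_val x.1 x.2)).trans (cover_ρ_pow_val _ x.2).symm
  admissible := fun x n e => by
    have := (cover_ρ_zpow_val x.1 x.2 n).symm.trans e
    exact (hI.opposite_spec x.1).1 (congrArg Prod.fst this).symm

end IsGentle

end

noncomputable section
open Quiver

universe u v w

/-! ### Periodic sequences -/

namespace BiSeq

variable {k : Type u} [Field k] {A : Type v} [NonUnitalRing A] [Module k A]
variable {J : Type w} [AddCommGroupWithOne J]

variable (k A J) in
/-- The sequence on `ℤ` that a finitely supported function on `J` induces along `ℤ → J`. -/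
def periodize : (J →₀ A × Module.Dual k A) →ₗ[k] BiSeq k A where
  toFun f i := f i
  map_add' _ _ := rfl
  map_smul' _ _ := rfl

theorem periodize_apply (f : J →₀ A × Module.Dual k A) (i : ℤ) : periodize k A J f i = f i := rfl

theorem periodize_injective (hJ : Function.Surjective (Int.cast : ℤ → J)) :
    Function.Injective (periodize k A J) := fun f g h => by
  ext1 j
  obtain ⟨i, rfl⟩ := hJ j
  exact congrFun h i

theorem linearIndependent_periodize (hJ : Function.Surjective (Int.cast : ℤ → J)) {ι : Type*}
    {b : ι → J →₀ A × Module.Dual k A} (hb : LinearIndependent k b) :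
    LinearIndependent k (periodize k A J ∘ b) := by
  unfold LinearIndependent at hb ⊢
  intro l l' h
  rw [← Finsupp.apply_linearCombination, ← Finsupp.apply_linearCombination] at h
  exact hb (periodize_injective hJ h)

/-- The sequence with the entry `x` at the places above `j`. -/
def single (j : J) (x : A × Module.Dual k A) : BiSeq k A := periodize k A J (Finsupp.single j x)

theorem single_apply_of_eq {j : J} {x : A × Module.Dual k A} {i : ℤ} (h : (i : J) = j) :
    single j x i = x := by
  rw [single, periodize_apply, h, Finsupp.single_eq_same]

theorem single_apply_of_ne {j : J} {x : A × Module.Dual k A} {i : ℤ} (h : (i : J) ≠ j) :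
    single j x i = 0 := by
  rw [single, periodize_apply, Finsupp.single_eq_of_ne h]

theorem single_zero (j : J) : single j (0 : A × Module.Dual k A) = 0 := by
  rw [single, Finsupp.single_zero, map_zero]

theorem mem_range_periodize_int [IsScalarTower k A A] [SMulCommClass k A A] (x : BiSeq k A) :
    x ∈ LinearMap.range (periodize k A ℤ) ↔ x ∈ RepetitiveAlgebra k A := by
  constructor
  · rintro ⟨f, rfl⟩
    exact f.hasFiniteSupport.subset fun i hi => hi
  · intro hx
    exact ⟨Finsupp.ofSupportFinite x hx, rfl⟩

variable [IsScalarTower k A A] [SMulCommClass k A A]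

theorem nakayama_iterate (r : ℕ) (x : BiSeq k A) (i : ℤ) :
    (nakayama k A)^[r] x i = x (i - r) := by
  induction r generalizing i with
  | zero => simp
  | succ r ih =>
    rw [Function.iterate_succ_apply']
    refine (ih (i - 1)).trans (congrArg x ?_)
    push_cast
    ring

/-- Invariance under `ν^r` is `r`-periodicity, and on the finite set `ℤ/r` finite support is no
condition. -/
theorem mem_range_periodize_zmod {r : ℕ} (hr : 0 < r) (x : BiSeq k A) :
    x ∈ LinearMap.range (periodize k A (ZMod r)) ↔ x ∈ TrivialExtension k A r := by
  change _ ↔ (nakayama k A)^[r] x = x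
  constructor
  · rintro ⟨f, rfl⟩
    funext i
    rw [nakayama_iterate, periodize_apply, periodize_apply]
    simp
  · intro hx
    have : NeZero r := ⟨hr.ne'⟩
    have h1 : ∀ i, x (i - r) = x i := fun i =>
      (nakayama_iterate r x i).symm.trans (congrFun hx i)
    have h2 : ∀ (n : ℕ) i, x (i + r * n) = x i := by
      intro n i
      induction n with
      | zero => simp
      | succ n ih =>
        rw [← ih, ← h1 (i + r * (n + 1 : ℕ))]
        congr 1
        push_cast
        ring
    refine ⟨Finsupp.equivFunOnFinite.symm fun j : ZMod r => x j.val, funext fun i => ?_⟩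
    rw [periodize_apply, Finsupp.equivFunOnFinite_symm_apply_apply, ZMod.val_intCast]
    -- Periodicity `h2` is available for natural multiples only; for a negative quotient it is
    -- applied at `i` instead of at the remainder.
    obtain ⟨n, hn | hn⟩ := (i / r).eq_nat_or_neg
    · rw [← h2 n, ← hn, Int.emod_add_mul_ediv]
    · rw [← h2 n i]
      congr 1
      have := Int.emod_add_mul_ediv i r
      rw [hn] at this
      linarith

/-- These product rules take a left factor purely in `A` or purely in `DA`; in this form they hold
for every `J`, even when `j + 1 = j` as for `r = 1`. -/
theorem single_inl_mul_single (j : J) (a b : A) (g : Module.Dual k A) :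
    single j (a, (0 : Module.Dual k A)) * single j (b, g) = single j (a * b, dualLeft a g) := by
  funext i
  rw [mul_apply]
  by_cases h : (i : J) = j
  · rw [single_apply_of_eq h, single_apply_of_eq h, single_apply_of_eq h]
    simp [dualRight]
  · rw [single_apply_of_ne h, single_apply_of_ne h, single_apply_of_ne h]
    simp [dualRight, dualLeft]

theorem single_inl_mul_single_of_ne {j j' : J} (hj : j ≠ j') (a : A) (x : A × Module.Dual k A) :
    single j (a, (0 : Module.Dual k A)) * single j' x = 0 := by
  funext i
  rw [mul_apply]
  by_cases h : (i : J) = j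
  · rw [single_apply_of_eq h, single_apply_of_ne (h.trans_ne hj)]
    simp [dualRight, dualLeft, zero_apply]
  · rw [single_apply_of_ne h]
    simp [dualRight, dualLeft, zero_apply]

theorem single_inr_mul_single {j j' : J} (hj : j' = j + 1) (f : Module.Dual k A)
    (x : A × Module.Dual k A) :
    single j ((0 : A), f) * single j' x = single j (0, dualRight f x.1) := by
  subst hj
  funext i
  rw [mul_apply]
  by_cases h : (i : J) = j
  · rw [single_apply_of_eq h, single_apply_of_eq h,
      single_apply_of_eq (show ((i + 1 : ℤ) : J) = j + 1 by push_cast; rw [h])]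
    simp [dualLeft]
  · rw [single_apply_of_ne h, single_apply_of_ne h]
    simp [dualRight, dualLeft]

theorem single_inr_mul_single_inr (j j' : J) (f g : Module.Dual k A) :
    single j ((0 : A), f) * single j' ((0 : A), g) = 0 := by
  funext i
  rw [mul_apply]
  have h1 : ∀ i, (single j ((0 : A), f) i).1 = 0 := fun i => by
    by_cases h : (i : J) = j
    · rw [single_apply_of_eq h]
    · rw [single_apply_of_ne h]; rfl
  have h2 : ∀ i, (single j' ((0 : A), g) i).1 = 0 := fun i => by
    by_cases h : (i : J) = j'
    · rw [single_apply_of_eq h]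
    · rw [single_apply_of_ne h]; rfl
  simp [h1, h2, dualRight, dualLeft, zero_apply]

end BiSeq

/-- A linear map that sends a spanning family to a linearly independent family is injective. -/
theorem LinearMap.injective_of_linearIndependent_of_span_eq_top {k M N ι : Type*} [Field k]
    [AddCommGroup M] [Module k M] [AddCommGroup N] [Module k N] (f : M →ₗ[k] N) {b : ι → M}
    (hb : Submodule.span k (Set.range b) = ⊤) (hf : LinearIndependent k (f ∘ b)) :
    Function.Injective f := by
  rw [injective_iff_map_eq_zero]
  intro x hx
  obtain ⟨c, rfl⟩ := (Finsupp.mem_span_range_iff_exists_finsupp (R := k) (v := b) (x := x)).1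
    (hb ▸ Submodule.mem_top)
  change f (Finsupp.linearCombination k b c) = 0 at hx
  rw [Finsupp.apply_linearCombination] at hx
  rw [linearIndependent_iff.1 hf c hx]
  simp

end

/-! ### The isomorphism between the algebra of the covering and the algebra of sequences -/

noncomputable section
open Quiver

universe u v w

open PathAlgebra GentleHalfEdge BiSeq

variable {k : Type w} [Field k] {Q : Type u} [Quiver.{v} Q] (I : TwoSidedIdeal (PathAlgebra k Q))

/-- The class of a path in `kQ/I`. -/
def pathClass {a b : Q} (p : Path a b) : BoundQuiverAlgebra I :=
  BoundQuiverAlgebra.mk I (ofPath k p)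

theorem pathClass_mul {a b c : Q} (p : Path b c) (q : Path a b) :
    pathClass I p * pathClass I q = pathClass I (q.comp p) := by
  rw [pathClass, pathClass, ← BoundQuiverAlgebra.mk_mul, ofPath_mul_ofPath, pathClass]

theorem pathClass_mul_of_ne {a b b' c : Q} (p : Path b c) (q : Path a b') (h : b' ≠ b) :
    pathClass I p * pathClass I q = 0 := by
  rw [pathClass, pathClass, ← BoundQuiverAlgebra.mk_mul, ofPath_mul_ofPath_of_ne _ _ h,
    BoundQuiverAlgebra.mk_zero]

variable {J : Type*} [AddCommGroupWithOne J]

/-- The image of the idempotent at the edge of a half-edge of the covering. -/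
def idemImage (x : GentleHalfEdge I × J) : BiSeq k (BoundQuiverAlgebra I) :=
  single (-x.2) (pathClass I (.nil : Path x.1.point _), 0)

/-- The image of the arrow `α_x`. -/
def arrowImage : GentleHalfEdge I × J → BiSeq k (BoundQuiverAlgebra I)
  -- Here `p` is the whole maximal path. A functional at place `i` takes right factors at `i + 1`
  -- and left factors at `i`; as the arrow leads from sheet `j` to `j + 1`, sheets correspond to the
  -- negatives of places.
  | (.pass p .nil _, j) => single (-(j + 1)) (0, pathDual I p)
  | (.pass _ (.cons q β) _, j) =>
    single (-j) (pathClass I (splitFirst (q.cons β) (Nat.succ_pos _)).1.2.1.toPath, 0)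
  | (.added x _, j) => single (-(j + 1)) (0, pathDual I (.nil : Path x x))

variable {I}

theorem arrowImage_pass {a x y b : Q} (p : Path a x) (β : x ⟶ y) (q : Path y b)
    (h : IsMaximalPath I (p.comp (β.toPath.comp q))) (j : J) :
    arrowImage I (pass p (β.toPath.comp q) h, j) = single (-j) (pathClass I β.toPath, 0) := by
  have split := splitFirst_toPath_comp β q
  have pos : 0 < (β.toPath.comp q).length := by
    rw [Path.length_comp]
    exact Nat.add_pos_left Nat.one_pos _
  generalize β.toPath.comp q = q' at h split pos
  cases q' with
  | nil => exact (Nat.lt_irrefl 0 pos).elim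
  | cons q' γ =>
    rw [arrowImage, split pos]

/-- The arrow of a half-edge is dual to a path of `Q` or an arrow of `Q`. -/
theorem IsGentle.arrow_cases (hI : IsGentle I) (h : GentleHalfEdge I) :
    (∃ (a b : Q) (m : Path a b), ofPath k m ∉ I ∧ h.IsLast ∧ h.point = b ∧ h.next.point = a ∧
      (∀ j : J, arrowImage I (h, j) = single (-(j + 1)) (0, pathDual I m)) ∧
      ((∃ hm, h = pass m .nil hm) ∨ m.length = 0)) ∨
    ∃ (x y : Q) (β : x ⟶ y), ¬ h.IsLast ∧ h.point = x ∧ h.next.point = y ∧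
      (∀ j : J, arrowImage I (h, j) = single (-j) (pathClass I β.toPath, 0)) ∧
      ∃ (a b : Q) (p : Path a x) (q : Path y b) (hq : IsMaximalPath I (p.comp (β.toPath.comp q)))
        (hq' : IsMaximalPath I ((p.cons β).comp q)),
        h = pass p (β.toPath.comp q) hq ∧ h.next = pass (p.cons β) q hq' := by
  cases h with
  | @pass a x b p q h =>
    by_cases hq : q.length = 0
    · obtain rfl := Path.eq_of_length_zero q hq
      obtain rfl := Path.eq_nil_of_length_zero q hq
      exact .inl ⟨a, x, p, h.ne_zero, hq, rfl, rfl, fun _ => rfl, .inl ⟨h, rfl⟩⟩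
    · obtain ⟨z, β, q, rfl, -⟩ := (Path.length_ne_zero_iff_eq_comp q).1 hq
      have h' : IsMaximalPath I ((p.cons β).comp q) := by
        rwa [← Path.comp_toPath_eq_cons, Path.comp_assoc]
      have e := next_pass p β q h h'
      exact .inr ⟨x, z, β, hq, rfl, by rw [e, point], arrowImage_pass p β q h,
        a, b, p, q, h, h', rfl, e⟩
  | added x hx =>
    exact .inl ⟨x, x, .nil, hI.nil_notMem x, trivial, rfl, rfl, fun _ => rfl, .inr rfl⟩

namespace IsGentle

variable (hI : IsGentle I)
include hI

theorem idemImage_mul_arrowImage (x : GentleHalfEdge I × J) :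
    idemImage I ((gentleCover I J).ρ x) * arrowImage I x = arrowImage I x := by
  obtain ⟨h, j⟩ := x
  rcases hI.arrow_cases (J := J) h with ⟨a, b, m, hm, hl, hb, ha, e, -⟩ | ⟨x, y, β, hl, hx, hy, e, -⟩
  · rw [cover_ρ_of_isLast hl, e, idemImage]
    subst ha
    have hm' : ofPath k ((Path.nil : Path h.next.point h.next.point).comp m) ∉ I := by
      rwa [Path.nil_comp]
    have := hI.dualLeft_pathDual hm'
    rw [Path.nil_comp] at this
    rw [single_inl_mul_single, mul_zero]
    exact congrArg (fun f => single (-(j + 1)) ((0 : BoundQuiverAlgebra I), f)) this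
  · rw [cover_ρ_of_not_isLast hl, e, idemImage]
    subst hy
    rw [single_inl_mul_single, pathClass_mul, Path.comp_nil]
    simp [dualLeft]

theorem arrowImage_mul_idemImage (x : GentleHalfEdge I × J) :
    arrowImage I x * idemImage I x = arrowImage I x := by
  obtain ⟨h, j⟩ := x
  rcases hI.arrow_cases (J := J) h with ⟨a, b, m, hm, hl, hb, ha, e, -⟩ | ⟨x, y, β, hl, hx, hy, e, -⟩
  · rw [e, idemImage]
    subst hb
    have hm' : ofPath k (m.comp (Path.nil : Path h.point h.point)) ∉ I := hm
    rw [single_inr_mul_single (by abel)]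
    exact congrArg (fun f => single (-(j + 1)) ((0 : BoundQuiverAlgebra I), f))
      (hI.dualRight_pathDual hm')
  · rw [e, idemImage]
    subst hx
    rw [single_inl_mul_single, pathClass_mul, Path.nil_comp]
    simp [dualLeft]

omit hI in
theorem idemImage_mul_self (x : GentleHalfEdge I × J) :
    idemImage I x * idemImage I x = idemImage I x := by
  rw [idemImage, single_inl_mul_single, pathClass_mul, Path.comp_nil]
  simp [dualLeft]

variable (hJ : Function.Surjective (Int.cast : ℤ → J))
include hJ

/-- Since `ι` preserves sheets, the edges of the covering are indexed by pairs of a vertex of `Q`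
and a sheet. -/
theorem cover_edge_eq_iff {x y : GentleHalfEdge I × J} :
    (gentleCover I J).edge x = (gentleCover I J).edge y ↔ x.1.point = y.1.point ∧ x.2 = y.2 := by
  rw [(hI.isAFBG_cover hJ).isRibbonGraph.edge_eq_iff]
  constructor
  · rintro (rfl | rfl)
    · exact ⟨rfl, rfl⟩
    · exact ⟨(hI.opposite_spec x.1).2.symm, rfl⟩
  · rintro ⟨h1, h2⟩
    rcases hI.eq_or_eq_opposite h1.symm with h | h
    · exact .inl (Prod.ext h h2.symm)
    · exact .inr (Prod.ext h h2.symm)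

omit hI hJ in
theorem idemImage_congr {x y : GentleHalfEdge I × J} (h1 : x.1.point = y.1.point)
    (h2 : x.2 = y.2) : idemImage I x = idemImage I y := by
  rw [idemImage, idemImage, h1, h2]

/-- The homomorphism from the path algebra of `Q_Γ`, for the covering `Γ`. -/
def pathHom : PathAlgebra k (gentleCover I J).Edge →ₙₐ[k] BiSeq k (BoundQuiverAlgebra I) :=
  evalHom
    (Quot.lift (idemImage I) fun x y h => by
      have := (hI.cover_edge_eq_iff hJ).1 (Quot.sound h)
      exact idemImage_congr this.1 this.2)
    (fun _ _ α => arrowImage I α.1)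
    (by
      rintro ⟨x⟩
      exact idemImage_mul_self x)
    (by
      rintro ⟨x⟩ ⟨y⟩ hxy
      change idemImage I x * idemImage I y = 0
      by_cases h : x.2 = y.2
      · have h' : y.1.point ≠ x.1.point := fun h' => hxy
          ((hI.cover_edge_eq_iff hJ).2 ⟨h'.symm, h⟩)
        rw [idemImage, idemImage, h, single_inl_mul_single, pathClass_mul_of_ne _ _ _ h']
        simp [dualLeft, single_zero, ← Prod.zero_eq_mk]
      · exact single_inl_mul_single_of_ne (fun e => h (neg_injective e)) _ _)
    (by
      rintro _ _ ⟨x, rfl, rfl⟩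
      exact hI.idemImage_mul_arrowImage x)

theorem pathHom_runElt_zero (x : GentleHalfEdge I × J) :
    hI.pathHom hJ ((gentleCover I J).runElt k x 0) = idemImage I x :=
  evalHom_ofPath ..

theorem pathHom_arrowElt (x : GentleHalfEdge I × J) :
    hI.pathHom hJ ((gentleCover I J).arrowElt k x) = arrowImage I x :=
  (evalHom_ofPath ..).trans (hI.arrowImage_mul_idemImage x)

theorem pathHom_runElt_pass {a x y b : Q} (p : Path a x) (q : Path x y) (r : Path y b)
    (h : IsMaximalPath I (p.comp (q.comp r))) (j : J) :
    hI.pathHom hJ ((gentleCover I J).runElt k (pass p (q.comp r) h, j) q.length) =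
      single (-j) (pathClass I q, 0) := by
  induction q with
  | nil => exact hI.pathHom_runElt_zero hJ _
  | cons q β ih =>
    have e : (q.cons β).comp r = q.comp (β.toPath.comp r) := by
      rw [← Path.comp_toPath_eq_cons, Path.comp_assoc]
    have h1 : IsMaximalPath I (p.comp (q.comp (β.toPath.comp r))) := e ▸ h
    have h2 : IsMaximalPath I ((p.comp q).comp (β.toPath.comp r)) := by
      rwa [Path.comp_assoc]
    rw [pass_congr' rfl e h h1, Path.length_cons, RibbonData.runElt_succ,
      cover_ρ_pow_length p q _ h1 h2, map_mul, ih _ h1, pathHom_arrowElt, arrowImage_pass,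
      single_inl_mul_single, pathClass_mul, Path.comp_toPath_eq_cons]
    simp [dualLeft]

/-- For the maximal path `m` traversing `p`, `q`, `r`, this is `p m* r = q*`: the part `r` in sheet
`j` is cancelled from the end of `m`, and `p` in sheet `j + 1` from its start. -/
theorem pathHom_runElt_wrap {a x y b : Q} (p : Path a x) (q : Path x y) (r : Path y b)
    (h : IsMaximalPath I ((p.comp q).comp r)) (j : J) :
    hI.pathHom hJ ((gentleCover I J).runElt k (pass (p.comp q) r h, j)
      (r.length + 1 + p.length)) = single (-(j + 1)) (0, pathDual I q) := by
  have h0 : IsMaximalPath I ((p.comp q).comp (r.comp .nil)) := h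
  have h1 : IsMaximalPath I (((p.comp q).comp r).comp .nil) := h
  have h2 : IsMaximalPath I (Path.nil.comp ((p.comp q).comp r)) := by rwa [Path.nil_comp]
  have h3 : IsMaximalPath I (Path.nil.comp (p.comp (q.comp r))) := by
    rwa [Path.nil_comp, ← Path.comp_assoc]
  have h4 : ofPath k (p.comp q) ∉ I := fun hm => h.ne_zero (ofPath_mem_of_left hm)
  rw [RibbonData.runElt_add, RibbonData.runElt_succ, pow_succ', Equiv.Perm.mul_apply,
    pass_congr' rfl (Path.comp_nil r).symm h h0, cover_ρ_pow_length _ r .nil h0 h1,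
    cover_ρ_pass_nil _ h1 h2, pass_congr' rfl (Path.comp_assoc p q r) h2 h3, map_mul, map_mul,
    hI.pathHom_runElt_pass hJ .nil p (q.comp r) h3,
    hI.pathHom_runElt_pass hJ (p.comp q) r .nil h0, pathHom_arrowElt]
  change _ * (single (-(j + 1)) (0, pathDual I ((p.comp q).comp r)) * _) = _
  rw [single_inr_mul_single (by abel)]
  change _ * single (-(j + 1)) (0, dualRight _ (BoundQuiverAlgebra.mk I (ofPath k r))) = _
  rw [hI.dualRight_pathDual h.ne_zero, single_inl_mul_single, mul_zero]
  exact congrArg (fun f => single (-(j + 1)) ((0 : BoundQuiverAlgebra I), f))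
    (hI.dualLeft_pathDual h4)

/-- A full turn is the case of trivial `q` of the previous computation. Its value depends only on
the edge of `x`, which is the commutativity relation. -/
theorem pathHom_runElt_val (x : GentleHalfEdge I × J) :
    hI.pathHom hJ ((gentleCover I J).runElt k x ((gentleGraph I).val x.1.vertex)) =
      single (-(x.2 + 1)) (0, pathDual I (.nil : Path x.1.point _)) := by
  obtain ⟨h, j⟩ := x
  cases h with
  | @pass a y b p q h =>
    have e : (gentleGraph I).val (pass p q h).vertex = q.length + 1 + p.length := by
      rw [vertex, gentleGraph_val_path, Path.length_comp]
      omega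
    rw [e]
    exact hI.pathHom_runElt_wrap hJ p .nil q h j
  | added y hy =>
    rw [vertex, gentleGraph_val_added, RibbonData.runElt_one, pathHom_arrowElt]
    rfl

/-- Two closing arrows multiply to zero since `DA · DA = 0`. An arrow of `Q` acts on a functional
`m*` without killing it only if `m` starts (left action) or ends (right action) with it, and two
arrows of `Q` have nonzero product only if they are consecutive on a maximal path. In each nonzero
case uniqueness of maximal paths makes `y` the successor of `x`. -/
theorem arrowImage_mul_arrowImage_eq_zero {x y : GentleHalfEdge I × J}
    (e : (gentleCover I J).edge ((gentleCover I J).ρ x) = (gentleCover I J).edge y)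
    (hne : (gentleCover I J).ρ x ≠ y) : arrowImage I y * arrowImage I x = 0 := by
  obtain ⟨h, j⟩ := x
  obtain ⟨h', j'⟩ := y
  obtain ⟨e1, rfl⟩ := (hI.cover_edge_eq_iff hJ).1 e
  replace e1 : h.next.point = h'.point := e1
  replace hne : h.next ≠ h' := fun hh => hne (Prod.ext hh rfl)
  rcases hI.arrow_cases (J := J) h with ⟨a, b, m, hm, hl, hb, ha, e, hm'⟩ |
    ⟨x, y, β, hl, hx, hy, e, a, b, p, q, hq, hq', ep, en⟩
  · rw [cover_ρ_of_isLast hl, e]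
    rcases hI.arrow_cases (J := J) h' with ⟨a', b', m', -, hl', hb', ha', e', -⟩ |
      ⟨x', y', β', hl', hx', hy', e', a', b', p', q', hq', hq'', ep', en'⟩
    · rw [e', single_inr_mul_single_inr]
    · rw [e', single_inl_mul_single, mul_zero]
      refine (congrArg (fun f => single (-(j + 1)) ((0 : BoundQuiverAlgebra I), f))
        (hI.dualLeft_pathDual_eq_zero hm fun b'' r hr => ?_)).trans (single_zero _)
      cases hr
      rcases hm' with ⟨hm', rfl⟩ | hm'
      · have h0 : IsMaximalPath I (Path.nil.comp (β'.toPath.comp r)) := by rwa [Path.nil_comp]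
        exact hne ((hI.pass_left_unique (q := β'.toPath) Nat.one_pos h0 hq').trans ep'.symm)
      · rw [Path.length_comp, Path.length_toPath] at hm'
        omega
  · rw [cover_ρ_of_not_isLast hl, e]
    rcases hI.arrow_cases (J := J) h' with ⟨a', b', m', hm', hl', hb', ha', e', hm''⟩ |
      ⟨x', y', β', hl', hx', hy', e', a', b', p', q', hr', hr'', ep', en'⟩
    · rw [e', single_inr_mul_single (by abel)]
      refine (congrArg (fun f => single (-(j + 1)) ((0 : BoundQuiverAlgebra I), f))
        (hI.dualRight_pathDual_eq_zero hm' fun a'' r hr => ?_)).trans (single_zero _)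
      cases hr
      rcases hm'' with ⟨hm'', rfl⟩ | hm''
      · rw [en] at hne
        exact hne (hI.pass_right_unique (q := β.toPath) Nat.one_pos hq' hm'')
      · rw [Path.length_comp, Path.length_toPath] at hm''
        omega
    · obtain rfl : y = x' := hy.symm.trans (e1.trans hx')
      have hmem : ofPath k (β.toPath.cons β') ∈ I := by
        by_contra hββ
        obtain ⟨a'', b'', p'', q'', h'', -⟩ := hI.exists_pass _ hββ
        have h1 : IsMaximalPath I ((p''.cons β).comp (β'.toPath.comp q'')) := by
          rwa [← Path.comp_toPath_eq_cons, Path.comp_assoc, ← Path.comp_assoc β.toPath,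
            Path.comp_toPath_eq_cons]
        rw [en, ep'] at hne
        exact hne ((hI.pass_right_unique (q := β.toPath) Nat.one_pos hq' h1).trans
          (hI.pass_left_unique (q := β'.toPath) Nat.one_pos h1 hr'))
      have h0 : pathClass I (β.toPath.comp β'.toPath) = 0 := (BoundQuiverAlgebra.mk_eq_zero I).2 hmem
      rw [e', single_inl_mul_single, pathClass_mul, h0]
      simp [dualLeft, single_zero, ← Prod.zero_eq_mk]

theorem pathHom_eq_zero {x : PathAlgebra k (gentleCover I J).Edge}
    (hx : x ∈ (gentleCover I J).relationIdeal k (gentleGraph I).val) : hI.pathHom hJ x = 0 := by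
  have h : (gentleCover I J).relationIdeal k (gentleGraph I).val ≤
      TwoSidedIdeal.ker (hI.pathHom hJ) := by
    refine TwoSidedIdeal.span_le.2 fun y hy => (TwoSidedIdeal.mem_ker _).2 ?_
    cases hy with
    | commutativity h h' hh' =>
      obtain ⟨h1, h2⟩ := (hI.cover_edge_eq_iff hJ).1 hh'
      rw [map_sub, sub_eq_zero]
      refine (hI.pathHom_runElt_val hJ h).trans (Eq.trans ?_ (hI.pathHom_runElt_val hJ h').symm)
      rw [h1, h2]
    | zero h h' hh' hne =>
      rw [map_mul]
      refine Eq.trans ?_ (hI.arrowImage_mul_arrowImage_eq_zero hJ hh' hne)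
      exact congrArg₂ _ (hI.pathHom_arrowElt hJ h') (hI.pathHom_arrowElt hJ h)
  exact (TwoSidedIdeal.mem_ker _).1 (h hx)

/-- The homomorphism from the algebra of the covering to the algebra of sequences. -/
def coverHom : (gentleCover I J).AFBGA k (gentleGraph I).val →ₙₐ[k]
    BiSeq k (BoundQuiverAlgebra I) :=
  BoundQuiverAlgebra.lift (hI.pathHom hJ) fun _ => hI.pathHom_eq_zero hJ

/-- Runs that span the algebra of the covering, indexed by a basis of the algebra of sequences. -/
theorem exists_spanning_runs : ∃ v : (Σ _ : J, NonzeroPath I ⊕ NonzeroPath I) →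
    (gentleCover I J).AFBGA k (gentleGraph I).val,
    Submodule.span k (Set.range v) = ⊤ ∧ ∀ i, hI.coverHom hJ (v i) =
      periodize k _ J (Finsupp.basis (fun _ => hI.basis.prod hI.dualBasis) i) := by
  -- A maximal path around each nonzero path. For a nontrivial path there is no choice; for a
  -- trivial one it selects one half of an edge, which is immaterial modulo the ideal by `hzero` and
  -- `hval`.
  choose a b u w h h' using fun p : NonzeroPath I => hI.exists_pass p.1.2.2 p.2
  let run (x : GentleHalfEdge I × J) (n : ℕ) : (gentleCover I J).AFBGA k (gentleGraph I).val :=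
    BoundQuiverAlgebra.mk _ ((gentleCover I J).runElt k x n)
  let v : (Σ _ : J, NonzeroPath I ⊕ NonzeroPath I) →
      (gentleCover I J).AFBGA k (gentleGraph I).val
    -- The starting sheets `-j` and `-j - 1` make both images live at place `j`; the second run
    -- crosses the cut once.
    | ⟨j, .inl p⟩ => run (pass (u p) (p.1.2.2.comp (w p)) (h p), -j) p.1.2.2.length
    | ⟨j, .inr p⟩ => run (pass ((u p).comp p.1.2.2) (w p) (h' p), -j - 1)
        ((w p).length + 1 + (u p).length)
  refine ⟨v, ?_, ?_⟩
  · have hzero : ∀ x, run x 0 ∈ Set.range v := fun x => by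
      refine ⟨⟨-x.2, .inl ⟨⟨x.1.point, _, .nil⟩, hI.nil_notMem _⟩⟩,
        congrArg _ ((gentleCover I J).runElt_zero_congr k ?_)⟩
      exact (hI.cover_edge_eq_iff hJ).2 ⟨rfl, neg_neg _⟩
    have hval : ∀ x, run x ((gentleGraph I).val x.1.vertex) ∈ Set.range v := fun x => by
      set p : NonzeroPath I := ⟨⟨x.1.point, _, .nil⟩, hI.nil_notMem _⟩ with hp
      refine ⟨⟨-x.2 - 1, .inr p⟩, ?_⟩
      have e : (w p).length + 1 + (u p).length =
          (gentleGraph I).val (pass ((u p).comp p.1.2.2) (w p) (h' p)).vertex := by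
        rw [vertex, gentleGraph_val_path, Path.length_comp, Path.length_comp]
        simp only [p, Path.length_nil]
        omega
      have e' : (gentleCover I J).edge (pass ((u p).comp p.1.2.2) (w p) (h' p), -(-x.2 - 1) - 1) =
          (gentleCover I J).edge x :=
        (hI.cover_edge_eq_iff hJ).2 ⟨rfl, show -(-x.2 - 1) - 1 = x.2 by abel⟩
      exact (congrArg (run _) e).trans ((BoundQuiverAlgebra.mk_eq_mk _).2
        (RibbonData.runElt_sub_runElt_mem k e'))
    rw [eq_top_iff, ← RibbonData.span_range_runElt k (hI.isAFBG_cover hJ), Submodule.span_le]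
    rintro _ ⟨⟨g, j⟩, n, hn, rfl⟩
    refine Submodule.subset_span ?_
    change run (g, j) n ∈ Set.range v
    cases g with
    | @pass a₀ x b₀ p q hpq =>
      change n ≤ (gentleGraph I).val (pass p q hpq).vertex at hn
      rw [vertex, gentleGraph_val_path, Path.length_comp] at hn
      -- A run longer than `q` crosses the cut and covers an initial part of `p`; it belongs to the
      -- functional dual to the uncovered rest `r` of `p`. Otherwise it belongs to the initial part
      -- `r` of `q`. A trivial `r` means a full turn or a trivial path, respectively.
      rcases Nat.lt_or_ge q.length n with hq | hq
      · obtain ⟨i, rfl⟩ := Nat.exists_eq_add_of_lt hq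
        obtain ⟨y, p, r, rfl, rfl⟩ := p.exists_comp_eq_of_le_length (n := i) (by omega)
        by_cases hr : r.length = 0
        · obtain rfl := Path.eq_of_length_zero r hr
          obtain rfl := Path.eq_nil_of_length_zero r hr
          convert hval (pass (p.comp .nil) q hpq, j) using 2
          rw [vertex, gentleGraph_val_path, Path.length_comp, Path.length_comp]
          simp only [Path.length_nil]
          omega
        · set r' : NonzeroPath I := ⟨⟨y, x, r⟩, fun hm => hpq.ne_zero
            (ofPath_mem_of_left (ofPath_mem_of_right hm))⟩
          have h0 := hpq
          rw [Path.comp_assoc] at h0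
          obtain ⟨e1, e2⟩ := hI.isMaximalPath_unique (v := r) (Nat.pos_of_ne_zero hr) (h r') h0
          -- The chosen outer paths equal `p` and `q` only as dependent pairs, so they are
          -- generalized before the equalities are eliminated.
          have key : ∀ (a b : Q) (u : Path a y) (w : Path x b)
              (h' : IsMaximalPath I ((u.comp r).comp w)),
              (⟨a, u⟩ : Σ a, Path a y) = ⟨a₀, p⟩ → (⟨b, w⟩ : Σ b, Path x b) = ⟨b₀, q⟩ →
              run (pass (u.comp r) w h', -(-j - 1) - 1) (w.length + 1 + u.length) =
                run (pass (p.comp r) q hpq, j) (q.length + p.length + 1) := by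
            intro a b u w h' e1 e2
            cases e1
            cases e2
            rw [show -(-j - 1) - 1 = j by abel, add_right_comm]
          exact ⟨⟨-j - 1, .inr r'⟩, key _ _ _ _ _ e1 e2⟩
      · obtain ⟨y, r, q, rfl, rfl⟩ := q.exists_comp_eq_of_le_length hq
        by_cases hr : r.length = 0
        · rw [hr]
          exact hzero _
        · set r' : NonzeroPath I := ⟨⟨x, y, r⟩, fun hm => hpq.ne_zero
            (ofPath_mem_of_right (ofPath_mem_of_left hm))⟩
          obtain ⟨e1, e2⟩ := hI.isMaximalPath_unique (v := r) (Nat.pos_of_ne_zero hr) (h r') hpq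
          have key : ∀ (a b : Q) (u : Path a x) (w : Path y b)
              (h' : IsMaximalPath I (u.comp (r.comp w))),
              (⟨a, u⟩ : Σ a, Path a x) = ⟨a₀, p⟩ → (⟨b, w⟩ : Σ b, Path y b) = ⟨b₀, q⟩ →
              run (pass u (r.comp w) h', -(-j)) r.length =
                run (pass p (r.comp q) hpq, j) r.length := by
            intro a b u w h' e1 e2
            cases e1
            cases e2
            rw [neg_neg]
          exact ⟨⟨-j, .inl r'⟩, key _ _ _ _ _ e1 e2⟩
    | added x hx =>
      change n ≤ (gentleGraph I).val (.added x hx) at hn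
      rw [gentleGraph_val_added] at hn
      rcases Nat.le_one_iff_eq_zero_or_eq_one.1 hn with rfl | rfl
      · exact hzero _
      · have := hval (added x hx, j)
        rwa [vertex, gentleGraph_val_added] at this
  · rintro ⟨j, p | p⟩
    · have h1 : hI.coverHom hJ (v ⟨j, .inl p⟩) = single (- -j) (pathClass I p.1.2.2, 0) :=
        hI.pathHom_runElt_pass hJ _ _ _ _ _
      rw [h1, neg_neg, Finsupp.coe_basis]
      change _ = periodize k _ J (Finsupp.single j (hI.basis.prod hI.dualBasis (.inl p)))
      rw [Module.Basis.prod_apply, Sum.elim_inl,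
        Function.comp_apply, hI.basis_apply, LinearMap.inl_apply]
      rfl
    · have h1 : hI.coverHom hJ (v ⟨j, .inr p⟩) =
          single (-(-j - 1 + 1)) (0, pathDual I p.1.2.2) :=
        hI.pathHom_runElt_wrap hJ _ _ _ _ _
      rw [h1, show -(-j - 1 + 1) = j by abel, Finsupp.coe_basis]
      change _ = periodize k _ J (Finsupp.single j (hI.basis.prod hI.dualBasis (.inr p)))
      rw [Module.Basis.prod_apply, Sum.elim_inr, Function.comp_apply, hI.dualBasis_apply,
        LinearMap.inr_apply]
      rfl

/-- A spanning family with linearly independent image, so no basis of the algebra of the covering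
has to be known beforehand; the same family determines the range. -/
theorem coverHom_injective : Function.Injective (hI.coverHom hJ) := by
  obtain ⟨v, hv, hφ⟩ := hI.exists_spanning_runs hJ
  have h1 : LinearIndependent k (periodize k (BoundQuiverAlgebra I) J ∘
      Finsupp.basis fun _ : J => hI.basis.prod hI.dualBasis) :=
    linearIndependent_periodize hJ (Module.Basis.linearIndependent _)
  have h2 : (hI.coverHom hJ : (gentleCover I J).AFBGA k (gentleGraph I).val →ₗ[k]
      BiSeq k (BoundQuiverAlgebra I)) ∘ v = periodize k _ J ∘
        Finsupp.basis fun _ : J => hI.basis.prod hI.dualBasis := funext hφ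
  rw [← h2] at h1
  exact LinearMap.injective_of_linearIndependent_of_span_eq_top _ hv h1

theorem range_coverHom : LinearMap.range (hI.coverHom hJ :
    (gentleCover I J).AFBGA k (gentleGraph I).val →ₗ[k] BiSeq k (BoundQuiverAlgebra I)) =
    LinearMap.range (periodize k (BoundQuiverAlgebra I) J) := by
  obtain ⟨v, hv, hφ⟩ := hI.exists_spanning_runs hJ
  rw [LinearMap.range_eq_map, ← hv, LinearMap.range_eq_map,
    ← (Finsupp.basis fun _ : J => hI.basis.prod hI.dualBasis).span_eq, Submodule.map_span,
    Submodule.map_span, ← Set.range_comp, ← Set.range_comp]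
  exact congrArg (fun f => Submodule.span k (Set.range f)) (funext hφ)

/-- The algebra of the covering is isomorphic to the image of the sequences on `J`. -/
theorem exists_bijective (S : NonUnitalSubalgebra k (BiSeq k (BoundQuiverAlgebra I)))
    (hS : ∀ x, x ∈ LinearMap.range (periodize k (BoundQuiverAlgebra I) J) ↔ x ∈ S) :
    ∃ φ : (gentleCover I J).AFBGA k (gentleGraph I).val →ₙₐ[k] S, Function.Bijective φ := by
  have hmem : ∀ x, x ∈ S ↔ ∃ y, hI.coverHom hJ y = x := fun x => by
    rw [← hS, ← hI.range_coverHom hJ]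
    rfl
  refine ⟨NonUnitalAlgHom.codRestrict (hI.coverHom hJ) S fun x => (hmem _).2 ⟨x, rfl⟩,
    (NonUnitalAlgHom.injective_codRestrict _ _ _).2 (hI.coverHom_injective hJ), ?_⟩
  rintro ⟨x, hx⟩
  obtain ⟨y, rfl⟩ := (hmem x).1 hx
  exact ⟨y, rfl⟩

end IsGentle

end

theorem theorem3 {k : Type*} [Field k] {Q : Type*} [Quiver Q]
    (I : TwoSidedIdeal (PathAlgebra k Q)) (hI : IsGentle I) :
    (gentleGraph I).IsBrauerGraph (gentleGraph I).val ∧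
    (gentleGraph I).IsCuttingSet (gentleCut I) ∧
    (((gentleGraph I).cover (gentleCut I) ℤ).IsAFBG (gentleGraph I).val ∧
      ∃ φ : ((gentleGraph I).cover (gentleCut I) ℤ).AFBGA k (gentleGraph I).val →ₙₐ[k]
          RepetitiveAlgebra k (BoundQuiverAlgebra I),
        Function.Bijective φ) ∧
    ∀ r : ℕ, 0 < r →
      ((gentleGraph I).cover (gentleCut I) (ZMod r)).IsAFBG (gentleGraph I).val ∧
      ∃ φ : ((gentleGraph I).cover (gentleCut I) (ZMod r)).AFBGA k (gentleGraph I).val →ₙₐ[k]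
          TrivialExtension k (BoundQuiverAlgebra I) r,
        Function.Bijective φ := by
  have hint : Function.Surjective (Int.cast : ℤ → ℤ) := fun n => ⟨n, Int.cast_id⟩
  exact ⟨hI.isBrauerGraph, isCuttingSet_gentleCut,
    ⟨hI.isAFBG_cover hint, hI.exists_bijective hint _ BiSeq.mem_range_periodize_int⟩,
    fun r hr => ⟨hI.isAFBG_cover ZMod.intCast_surjective,
      hI.exists_bijective ZMod.intCast_surjective _ (BiSeq.mem_range_periodize_zmod hr)⟩⟩
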